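/- Let $p_0,\dots,p_4\ge 1$ be integers, $d=p_0+\cdots+p_4-3$, and let $b_1,\dots,b_{p_3}$ and $c_1,\dots,c_{p_2}$ be nonnegative integers, at least one of which is $0$ (normalization; the usual convention $c_1=0$ is a special case). Consider sets $X_0=\{v_i\}_{i=1}^{p_0}$, $X_1=\{y_i\}_{i=1}^{p_1}$, $X_2=\{z_i\}_{i=1}^{p_2}$, $X_3=\{t_i\}_{i=1}^{p_3}$, $X_4=\{u_i\}_{i=1}^{p_4}$ of vectors of $N=\mathbb Z^d$, where all the vectors except $y_1,z_1,u_1$ form the standard basis of $\mathbb Z^d$ and $$z_1=-\sum_{i\ge2}z_i-\sum_i t_i,\qquad u_1=-\sum_{i\ge2}u_i-\sum_i v_i+\sum_{i=1}^{p_2}c_iz_i+\sum_{i=1}^{p_3}b_it_i,\qquad y_1=-\sum_{i\ge2}y_i-\sum_{i}z_i+\sum_i u_i .$$ Put $P_i=X_i\cup X_{i+1}$ (indices modulo $5$), and let $\Sigma^*$ be the fan whose cones are generated by the subsets of $X_0\cup\cdots\cup X_4$ containing none of $P_0,\dots,P_4$ (the fan of a Batyrev variety $X(\Sigma^*)$: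 smooth projective, of Picard rank $3$, with primitive collections $P_0,\dots,P_4$). For a fan $\Sigma$ in $N_{\mathbb R}$, a cone $\sigma\in\Sigma$ and a primitive $u\in N$ in the relative interior of $\sigma$, the star subdivision is $$\Sigma^*(\sigma,u)=\{\tau\in\Sigma:\sigma\not\subseteq\tau\}\cup\bigcup_{\sigma\subseteq\tau\in\Sigma}\{\operatorname{Cone}(R): R\subseteq\{u\}\cup\tau(1),\ \sigma(1)\not\subseteq R\},$$ where $\tau(1)$ is the set of primitive generators of the rays of $\tau$. We say that $X(\Sigma^*)$ has an equivariant blowdown along $(P,u)$ to $X(\Sigma)$ if $\Sigma^*=\Sigma^*(\sigma,u)$ for a cone $\sigma\in\Sigma$ with $\sigma(1)=P$, where $P$ is a primitive collection of $\Sigma^*$ (a set of rays that does not generate a cone of $\Sigma^*$ although all its proper subsets do). Then, for a finite set $P\subseteq N$ and $u\in N$, the variety $X(\Sigma^*)$ has an equivariant blowdown along $(P,u)$ to a smooth projective toric variety of Picard rank $2$ if and only if one of the following holds: (a) $p_3=1$, $b_1=0$, all $c_i$ vanish, and $(P,u)=(P_0,t_1)$; (b) $p_4=1$ and $(P,u)=(P_1,u_1)$;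 (c) $p_1=1$ and $(P,u)=(P_3,y_1)$; (d) $p_2=1$, $c_1=1$, all $b_i$ vanish, and $(P,u)=(P_4,z_1)$. -/

import Mathlib

/-! Simplicial fans in the lattice `N = ι → ℤ` (inside `N_ℝ = ι → ℝ`). A simplicial cone is recorded
by the finite set of the primitive generators of its rays, so a simplicial fan is a set of finite
subsets of `N`. -/

namespace ToricFan

section Fans

variable {ι : Type*} [Fintype ι]

/-- The inclusion `N → N_ℝ`. -/
def toReal (x : ι → ℤ) : ι → ℝ := fun k => (x k : ℝ)

/-- A lattice vector is primitive if it is not a multiple `k • w` with `k ≠ 1` (in particular it is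
nonzero). -/
def IsPrimitive (x : ι → ℤ) : Prop :=
  ∀ (k : ℕ) (w : ι → ℤ), x = k • w → k = 1

/-- The convex cone in `N_ℝ` generated by a finite set of lattice vectors. -/
def cone (A : Finset (ι → ℤ)) : Set (ι → ℝ) :=
  {v | ∃ a : (ι → ℤ) → ℝ, (∀ x ∈ A, 0 ≤ a x) ∧ v = ∑ x ∈ A, a x • toReal x}

/-- The relative interior of the cone generated by a linearly independent set. -/
def relInterior (A : Finset (ι → ℤ)) : Set (ι → ℝ) :=
  {v | ∃ a : (ι → ℤ) → ℝ, (∀ x ∈ A, 0 < a x) ∧ v = ∑ x ∈ A, a x • toReal x}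

/-- Simplicial fans: a finite nonempty collection of simplicial cones with primitive ray generators,
closed under taking faces, any two of which meet in the common face spanned by the common
generators. -/
structure IsSimplicialFan (F : Set (Finset (ι → ℤ))) : Prop where
  finite : F.Finite
  nonempty : F.Nonempty
  primitive : ∀ A ∈ F, ∀ x ∈ A, IsPrimitive x
  linearIndependent : ∀ A ∈ F, LinearIndependent ℝ (fun x : A => toReal (x : ι → ℤ))
  face : ∀ A ∈ F, ∀ B ⊆ A, B ∈ F
  inter : ∀ A ∈ F, ∀ B ∈ F, cone A ∩ cone B = cone (A ∩ B)

/-- The fan covers `N_ℝ`. -/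
def IsComplete (F : Set (Finset (ι → ℤ))) : Prop :=
  ∀ v : ι → ℝ, ∃ A ∈ F, v ∈ cone A

/-- The generators of every cone are part of a `ℤ`-basis of `N`. -/
def IsRegular (F : Set (Finset (ι → ℤ))) : Prop :=
  ∀ A ∈ F, ∃ e : Module.Basis ι ℤ (ι → ℤ), (A : Set (ι → ℤ)) ⊆ Set.range e

/-- The pairing of `M = ℤ^ι` with `N_ℝ`. -/
def pairing (m : ι → ℤ) (v : ι → ℝ) : ℝ := ∑ k, (m k : ℝ) * v k

/-- A complete fan is projective if it has a strictly convex integral support function: there are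
`m_A ∈ M`, one for each cone `A` of full dimension, such that on each full-dimensional cone `B` one
has `m_B ≤ m_A`, with equality exactly on the points of `A`. -/
def IsProjective (F : Set (Finset (ι → ℤ))) : Prop :=
  IsComplete F ∧
    ∃ m : Finset (ι → ℤ) → (ι → ℤ),
      ∀ A ∈ F, A.card = Fintype.card ι → ∀ B ∈ F, B.card = Fintype.card ι →
        ∀ v ∈ cone B, pairing (m B) v ≤ pairing (m A) v ∧
          (pairing (m B) v = pairing (m A) v ↔ v ∈ cone A)

/-- The primitive generators of the rays of a fan. -/
def rays (F : Set (Finset (ι → ℤ))) : Set (ι → ℤ) := {x | {x} ∈ F}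

/-- The map `M → ℤ^{rays}` sending a character to the coefficients of its principal divisor. -/
def divMap (F : Set (Finset (ι → ℤ))) :
    Module.Dual ℤ (ι → ℤ) →ₗ[ℤ] (rays F → ℤ) :=
  LinearMap.pi fun x => Module.Dual.eval ℤ (ι → ℤ) (x : ι → ℤ)

/-- The Picard rank of the toric variety of a regular fan: the rank of the group of torus-invariant
divisors modulo principal ones (which is the Picard group, the variety being smooth). -/
noncomputable def picardRank (F : Set (Finset (ι → ℤ))) : ℕ :=
  Module.finrank ℤ ((rays F → ℤ) ⧸ LinearMap.range (divMap F))

/-- `P` is a set of rays which does not generate a cone, while all its proper subsets do. -/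
def IsPrimitiveCollection (F : Set (Finset (ι → ℤ))) (P : Finset (ι → ℤ)) : Prop :=
  (P : Set (ι → ℤ)) ⊆ rays F ∧ P ∉ F ∧ ∀ Q, Q ⊂ P → Q ∈ F

/-- The star subdivision of `F` relative to `(S, u)`. -/
def starSubdivision (F : Set (Finset (ι → ℤ))) (S : Finset (ι → ℤ)) (u : ι → ℤ) :
    Set (Finset (ι → ℤ)) :=
  {T | T ∈ F ∧ ¬ S ⊆ T} ∪ {R | ∃ T ∈ F, S ⊆ T ∧ R ⊆ insert u T ∧ ¬ S ⊆ R}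

/-- `F` is the fan of a smooth projective toric variety of Picard rank `ρ`. -/
def IsSmoothProjectiveOfPicardRank (F : Set (Finset (ι → ℤ))) (ρ : ℕ) : Prop :=
  IsSimplicialFan F ∧ IsRegular F ∧ IsProjective F ∧ picardRank F = ρ

/-- The fan `F` is the blowdown of the fan `F'` along `(P, u)`: the set `P` is a primitive collection
of `F'` and generates a cone of `F`, the vector `u` is a primitive vector in the relative interior of
that cone, and `F'` is the star subdivision of `F` relative to it. -/
def IsBlowdown (F' F : Set (Finset (ι → ℤ))) (P : Finset (ι → ℤ)) (u : ι → ℤ) : Prop :=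
  P ∈ F ∧ IsPrimitive u ∧ toReal u ∈ relInterior P ∧
    F' = starSubdivision F P u ∧ IsPrimitiveCollection F' P

end Fans

section Batyrev

/-- Labels of the rays: `⟨i, j⟩` is the `(j + 1)`-st element of `X_i`. The elements of
`X_0, X_1, X_2, X_3, X_4` are called `v, y, z, t, u` respectively. -/
abbrev RayIdx (p : Fin 5 → ℕ) : Type := Σ i : Fin 5, Fin (p i)

/-- Labels of the standard basis of the lattice: all rays except `y_1`, `z_1`, `u_1`. -/
abbrev BasisIdx (p : Fin 5 → ℕ) : Type :=
  {r : RayIdx p // ¬ ((r.2 : ℕ) = 0 ∧ (r.1 = 1 ∨ r.1 = 2 ∨ r.1 = 4))}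

/-- The lattice `ℤ^d` with `d = p_0 + p_1 + p_2 + p_3 + p_4 - 3`. -/
abbrev BLattice (p : Fin 5 → ℕ) : Type := BasisIdx p → ℤ

variable (p : Fin 5 → ℕ) (b : Fin (p 3) → ℕ) (c : Fin (p 2) → ℕ)

/-- The standard basis vector with label `r`, and `0` if `r` is one of `y_1`, `z_1`, `u_1`. -/
def stdVec (r : RayIdx p) : BLattice p := fun k => if k.1 = r then 1 else 0

/-- The sum of the elements of `X_i` that are standard basis vectors. -/
def stdSum (i : Fin 5) : BLattice p := ∑ j : Fin (p i), stdVec p ⟨i, j⟩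

/-- `z_1 = - z_2 - ⋯ - z_{p_2} - t_1 - ⋯ - t_{p_3}`. -/
def zOne : BLattice p := - stdSum p 2 - stdSum p 3

/-- The elements `z_1, …, z_{p_2}` of `X_2`. -/
def zVec (j : Fin (p 2)) : BLattice p := if (j : ℕ) = 0 then zOne p else stdVec p ⟨2, j⟩

/-- `u_1 = - u_2 - ⋯ - u_{p_4} - v_1 - ⋯ - v_{p_0} + (c_1 z_1 + ⋯ + c_{p_2} z_{p_2})
+ (b_1 t_1 + ⋯ + b_{p_3} t_{p_3})`. -/
def uOne : BLattice p :=
  - stdSum p 4 - stdSum p 0 + ∑ j, c j • zVec p j + ∑ j, b j • stdVec p ⟨3, j⟩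

/-- `y_1 = - y_2 - ⋯ - y_{p_1} - (z_1 + ⋯ + z_{p_2}) + (u_1 + ⋯ + u_{p_4})`. -/
def yOne : BLattice p :=
  - stdSum p 1 - (zOne p + stdSum p 2) + (uOne p b c + stdSum p 4)

/-- The ray generator with label `r`. -/
def ray (r : RayIdx p) : BLattice p :=
  if (r.2 : ℕ) = 0 ∧ r.1 = 1 then yOne p b c
  else if (r.2 : ℕ) = 0 ∧ r.1 = 2 then zOne p
  else if (r.2 : ℕ) = 0 ∧ r.1 = 4 then uOne p b c
  else stdVec p r

/-- The set `X_i`. -/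
def X (i : Fin 5) : Finset (BLattice p) :=
  Finset.univ.image fun j : Fin (p i) => ray p b c ⟨i, j⟩

/-- The set `P_i = X_i ∪ X_{i+1}`, indices modulo `5`. -/
def PC (i : Fin 5) : Finset (BLattice p) := X p b c i ∪ X p b c (i + 1)

/-- The fan with rays `X_0 ∪ ⋯ ∪ X_4` and primitive collections `P_0, …, P_4`: its cones are
generated by the sets of rays which contain no `P_i`. -/
def batyrevFan : Set (Finset (BLattice p)) :=
  {A | A ⊆ Finset.univ.image (ray p b c) ∧ ∀ i : Fin 5, ¬ PC p b c i ⊆ A}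

end Batyrev

end ToricFan

/-! Everything is read off the linear relations between the rays. They form a three-parameter family
(`relation`, `exists_relation`), spanned by the relations that define y_1, z_1 and u_1.

Necessity. The centre of a blowdown is some P_i. In a star subdivision, a cone containing the new
ray u can absorb any elements of the centre as long as it does not swallow the whole centre
(`IsBlowdown.union_mem`). If u lay in X_{i+2} or X_{i+4}, or if X_{i+3} had a second element, this
would turn P_{i+1} or P_{i+4} into a cone. So X_{i+3} = {u} (`IsBlowdown.center`). Regularity then
writes u as a positive integral combination of P_i, which is a relation that is positive on X_i and
X_{i+1}, equal to -1 on X_{i+3} and zero on X_{i+2} and X_{i+4}. Matching it with the general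
relation rules out i = 2. For i = 0 and i = 4 it gives an equation n * k = 1 in integers, which
together with the normalization of b and c yields the stated coefficients.

Sufficiency. If X_{i+3} = {u} and u is the sum of P_i, removing u leaves rays that split into
P_{i+1} and P_{i+4}. The fan with these two primitive collections has the Batyrev fan as its star
subdivision (`batyrevFan_eq_starSubdivision`). In each of the four cases one of the two sets sums to
zero and the sum of the other is a nonnegative combination of the first, as for a projectivized
split bundle over a projective space. Such fans are smooth and projective of Picard rank 2
(`IsKleinschmidt.isSmoothProjective`). -/

namespace ToricFan

/-! ### Lattice vectors, characters and coefficients with respect to part of a lattice basis. -/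

section General

variable {ι : Type*}

lemma toReal_sum {κ : Type*} (A : Finset κ) (f : κ → ι → ℤ) :
    toReal (∑ x ∈ A, f x) = ∑ x ∈ A, toReal (f x) := by
  funext k
  simp [toReal, Finset.sum_apply]

lemma toReal_nsmul (n : ℕ) (x : ι → ℤ) : toReal (n • x) = (n : ℝ) • toReal x := by
  funext k
  simp [toReal]

lemma toReal_single [DecidableEq ι] (k : ι) : toReal (Pi.single k 1) = Pi.single k (1 : ℝ) := by
  funext l
  by_cases h : l = k
  · subst h; simp [toReal]
  · simp [toReal, h]

/-- The coordinate functionals of a lattice basis, restricted to a set of basis vectors. -/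
lemma exists_dual {A : Finset (ι → ℤ)} (e : Module.Basis ι ℤ (ι → ℤ))
    (hA : (A : Set (ι → ℤ)) ⊆ Set.range e) {x : ι → ℤ} (hx : x ∈ A) :
    ∃ f : (ι → ℤ) →ₗ[ℤ] ℤ, f x = 1 ∧ ∀ y ∈ A, y ≠ x → f y = 0 := by
  classical
  obtain ⟨k, rfl⟩ := hA hx
  refine ⟨e.coord k, by simp, fun y hy hne => ?_⟩
  obtain ⟨l, rfl⟩ := hA hy
  have : l ≠ k := fun h => hne (by rw [h])
  simp [this]

lemma isPrimitive_of_functional {x : ι → ℤ} (f : (ι → ℤ) →ₗ[ℤ] ℤ) (hf : f x = 1) :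
    IsPrimitive x := by
  rintro k w rfl
  rw [map_nsmul, nsmul_eq_mul] at hf
  exact_mod_cast Int.eq_one_of_mul_eq_one_right (Int.natCast_nonneg k) hf

variable [Fintype ι]

/-- Every integral functional is a pairing with a character. -/
lemma exists_pairing_eq (f : (ι → ℤ) →ₗ[ℤ] ℤ) :
    ∃ m : ι → ℤ, ∀ x, pairing m (toReal x) = f x := by
  classical
  refine ⟨fun k => f (fun j => if k = j then 1 else 0), fun x => ?_⟩
  rw [LinearMap.pi_apply_eq_sum_univ f x]
  simp [pairing, toReal, mul_comm]

lemma pairing_sum (m : ι → ℤ) (A : Finset (ι → ℤ)) (a : (ι → ℤ) → ℝ) :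
    pairing m (∑ x ∈ A, a x • toReal x) = ∑ x ∈ A, a x * pairing m (toReal x) := by
  simp only [pairing, Finset.sum_apply, Pi.smul_apply, smul_eq_mul, Finset.mul_sum]
  rw [Finset.sum_comm]
  exact Finset.sum_congr rfl fun x _ => Finset.sum_congr rfl fun k _ => by ring

/-- Real coefficients with respect to part of a lattice basis can be read off by integral
functionals. -/
lemma coeff_eq_pairing {A : Finset (ι → ℤ)} (e : Module.Basis ι ℤ (ι → ℤ))
    (hA : (A : Set (ι → ℤ)) ⊆ Set.range e) {x : ι → ℤ} (hx : x ∈ A) :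
    ∃ m : ι → ℤ, ∀ a : (ι → ℤ) → ℝ, pairing m (∑ y ∈ A, a y • toReal y) = a x := by
  obtain ⟨f, hf1, hf0⟩ := exists_dual e hA hx
  obtain ⟨m, hm⟩ := exists_pairing_eq f
  refine ⟨m, fun a => ?_⟩
  rw [pairing_sum, Finset.sum_eq_single x]
  · simp [hm, hf1]
  · intro y hy hne
    simp [hm, hf0 y hy hne]
  · exact fun h => absurd hx h

lemma pairing_zero (m : ι → ℤ) : pairing m 0 = 0 := by simp [pairing]

lemma coeff_eq_zero_of_sum_eq_zero {A : Finset (ι → ℤ)} (e : Module.Basis ι ℤ (ι → ℤ))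
    (hA : (A : Set (ι → ℤ)) ⊆ Set.range e) {a : (ι → ℤ) → ℝ}
    (h : ∑ y ∈ A, a y • toReal y = 0) {x : ι → ℤ} (hx : x ∈ A) : a x = 0 := by
  obtain ⟨m, hm⟩ := coeff_eq_pairing e hA hx
  rw [← hm a, h, pairing_zero]

lemma coeff_integral {A : Finset (ι → ℤ)} (e : Module.Basis ι ℤ (ι → ℤ))
    (hA : (A : Set (ι → ℤ)) ⊆ Set.range e) {a : (ι → ℤ) → ℝ} {u : ι → ℤ}
    (h : toReal u = ∑ y ∈ A, a y • toReal y) {x : ι → ℤ} (hx : x ∈ A) :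
    ∃ n : ℤ, a x = n := by
  obtain ⟨m, hm⟩ := coeff_eq_pairing e hA hx
  refine ⟨∑ k, m k * u k, ?_⟩
  rw [← hm a, ← h]
  simp [pairing, toReal]

lemma linearIndependent_of_basis {A : Finset (ι → ℤ)} (e : Module.Basis ι ℤ (ι → ℤ))
    (hA : (A : Set (ι → ℤ)) ⊆ Set.range e) :
    LinearIndependent ℝ (fun x : A => toReal (x : ι → ℤ)) := by
  classical
  rw [Fintype.linearIndependent_iff]
  intro g hg x
  have h : ∑ y ∈ A, (fun y => if hy : y ∈ A then g ⟨y, hy⟩ else 0) y • toReal y = 0 := by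
    rw [← hg, ← Finset.sum_coe_sort A]
    exact Finset.sum_congr rfl fun y _ => by simp
  simpa using coeff_eq_zero_of_sum_eq_zero e hA h x.2

/-- Points of a cone on rays from `U`, in terms of coefficient functions on `U`. -/
lemma mem_cone_iff {A U : Finset (ι → ℤ)} (hAU : A ⊆ U) {v : ι → ℝ} :
    v ∈ cone A ↔ ∃ a : (ι → ℤ) → ℝ, (∀ x, 0 ≤ a x) ∧ (∀ x, x ∉ A → a x = 0) ∧
      v = ∑ x ∈ U, a x • toReal x := by
  constructor
  · rintro ⟨a, ha, rfl⟩
    refine ⟨fun x => if x ∈ A then a x else 0, fun x => ?_, fun x hx => by simp [hx], ?_⟩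
    · dsimp only
      split_ifs with h
      exacts [ha x h, le_rfl]
    · rw [← Finset.sum_subset hAU]
      · exact Finset.sum_congr rfl fun x hx => by simp [hx]
      · intro x _ hx
        simp [hx]
  · rintro ⟨a, ha, h0, rfl⟩
    refine ⟨a, fun x _ => ha x, ?_⟩
    rw [← Finset.sum_subset hAU]
    intro x _ hx
    simp [h0 x hx]

end General

/-! ### Fans of projectivized split bundles: smooth, projective, of Picard rank 2. -/

section Kleinschmidt

variable {ι : Type*} [Fintype ι]

/-- The rays of a projectivized split bundle over a projective space: `S` are the rays of the fibre,
`Q` those which lie over the rays of the base. -/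
structure IsKleinschmidt (S Q : Finset (ι → ℤ)) (m : (ι → ℤ) → ℕ) : Prop where
  disjoint : Disjoint S Q
  one_lt_left : 1 < S.card
  one_lt_right : 1 < Q.card
  card : S.card + Q.card = Fintype.card ι + 2
  span : Submodule.span ℤ ((S ∪ Q : Finset (ι → ℤ)) : Set (ι → ℤ)) = ⊤
  sum_left : ∑ x ∈ S, x = 0
  sum_right : ∑ x ∈ Q, x = ∑ x ∈ S, m x • x

/-- The sets of rays in `S ∪ Q` which contain neither `S` nor `Q`. -/
def kleinschmidtFan (S Q : Finset (ι → ℤ)) : Set (Finset (ι → ℤ)) :=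
  {A | A ⊆ S ∪ Q ∧ ¬ S ⊆ A ∧ ¬ Q ⊆ A}

namespace IsKleinschmidt

variable {S Q : Finset (ι → ℤ)} {m : (ι → ℤ) → ℕ}

/-- The two sum relations recover s and then q from the remaining rays, so those still span; their
number equals the rank, hence they are independent. -/
lemma exists_basis (h : IsKleinschmidt S Q m) {s q : ι → ℤ} (hs : s ∈ S) (hq : q ∈ Q) :
    ∃ e : Module.Basis ι ℤ (ι → ℤ), Set.range e = (((S ∪ Q).erase s).erase q : Finset _) := by
  classical
  set B := ((S ∪ Q).erase s).erase q with hB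
  have hsq : ∀ x ∈ S, x ∉ Q := fun x hx hx' => Finset.disjoint_left.1 h.disjoint hx hx'
  have hmem : ∀ x ∈ B, x ∈ Submodule.span ℤ (B : Set (ι → ℤ)) :=
    fun x hx => Submodule.subset_span hx
  have hS' : ∀ x ∈ S.erase s, x ∈ B := by
    intro x hx
    rw [Finset.mem_erase] at hx
    simp only [hB, Finset.mem_erase, Finset.mem_union]
    exact ⟨fun e => hsq x hx.2 (e ▸ hq), hx.1, Or.inl hx.2⟩
  have hQ' : ∀ x ∈ Q.erase q, x ∈ B := by
    intro x hx
    rw [Finset.mem_erase] at hx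
    simp only [hB, Finset.mem_erase, Finset.mem_union]
    exact ⟨hx.1, fun e => hsq s hs (e ▸ hx.2), Or.inr hx.2⟩
  have hs' : s ∈ Submodule.span ℤ (B : Set (ι → ℤ)) := by
    have e := h.sum_left
    rw [← Finset.add_sum_erase S (fun x => x) hs] at e
    rw [eq_neg_of_add_eq_zero_left e]
    exact neg_mem (sum_mem fun x hx => hmem x (hS' x hx))
  have hSall : ∀ x ∈ S, x ∈ Submodule.span ℤ (B : Set (ι → ℤ)) := by
    intro x hx
    by_cases e : x = s
    · rwa [e]
    · exact hmem x (hS' x (Finset.mem_erase.2 ⟨e, hx⟩))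
  have hq' : q ∈ Submodule.span ℤ (B : Set (ι → ℤ)) := by
    have e := h.sum_right
    rw [← Finset.add_sum_erase Q (fun x => x) hq] at e
    rw [eq_sub_of_add_eq e]
    exact sub_mem (sum_mem fun x hx => Submodule.smul_of_tower_mem _ _ (hSall x hx))
      (sum_mem fun x hx => hmem x (hQ' x hx))
  have htop : ⊤ ≤ Submodule.span ℤ (Set.range (fun x : B => (x : ι → ℤ))) := by
    rw [← h.span, Submodule.span_le]
    intro x hx
    have hr : Set.range (fun x : B => (x : ι → ℤ)) = (B : Set (ι → ℤ)) := by
      ext y; simp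
    rw [hr]
    rcases Finset.mem_union.1 (Finset.mem_coe.1 hx) with hx | hx
    · exact hSall x hx
    · by_cases e : x = q
      · rwa [e]
      · exact hmem x (hQ' x (Finset.mem_erase.2 ⟨e, hx⟩))
  have hcard : Fintype.card B = Fintype.card ι := by
    rw [Fintype.card_coe, hB, Finset.card_erase_of_mem, Finset.card_erase_of_mem,
      Finset.card_union_of_disjoint h.disjoint, h.card]
    · omega
    · exact Finset.mem_union_left _ hs
    · exact Finset.mem_erase.2 ⟨fun e => hsq s hs (e ▸ hq), Finset.mem_union_right _ hq⟩
  have hli := linearIndependent_of_top_le_span_of_card_eq_finrank htop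
    (by rw [hcard, Module.finrank_pi])
  refine ⟨(Module.Basis.mk hli htop).reindex (Fintype.equivOfCardEq hcard), ?_⟩
  rw [Module.Basis.range_reindex, Module.Basis.coe_mk]
  ext y; simp

lemma exists_basis_of_mem (h : IsKleinschmidt S Q m) {A : Finset (ι → ℤ)}
    (hA : A ∈ kleinschmidtFan S Q) :
    ∃ e : Module.Basis ι ℤ (ι → ℤ), (A : Set (ι → ℤ)) ⊆ Set.range e := by
  obtain ⟨hsub, hS, hQ⟩ := hA
  obtain ⟨s, hs, hsA⟩ := Finset.not_subset.1 hS
  obtain ⟨q, hq, hqA⟩ := Finset.not_subset.1 hQ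
  obtain ⟨e, he⟩ := h.exists_basis hs hq
  refine ⟨e, ?_⟩
  rw [he]
  intro x hx
  have hx : x ∈ A := hx
  simp only [Finset.mem_coe, Finset.mem_erase]
  exact ⟨fun e => hqA (e ▸ hx), fun e => hsA (e ▸ hx), hsub hx⟩

lemma coeff_eq_zero (h : IsKleinschmidt S Q m) {s q : ι → ℤ} (hs : s ∈ S) (hq : q ∈ Q)
    {a : (ι → ℤ) → ℝ} (has : a s = 0) (haq : a q = 0)
    (ha : ∑ x ∈ S ∪ Q, a x • toReal x = 0) : ∀ x ∈ S ∪ Q, a x = 0 := by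
  classical
  obtain ⟨e, he⟩ := h.exists_basis hs hq
  intro x hx
  by_cases hxs : x = s
  · rwa [hxs]
  by_cases hxq : x = q
  · rwa [hxq]
  refine coeff_eq_zero_of_sum_eq_zero (A := ((S ∪ Q).erase s).erase q) e he.ge ?_
    (by simp only [Finset.mem_erase]; exact ⟨hxq, hxs, hx⟩)
  rw [Finset.sum_erase _ (by simp [haq]), Finset.sum_erase _ (by simp [has]), ha]

/-- The coefficients of the relation `l • ∑ S + k • (∑ Q - ∑ m_s s) = 0`. -/
def relCoeff (S Q : Finset (ι → ℤ)) (m : (ι → ℤ) → ℕ) (l k : ℝ) (x : ι → ℤ) : ℝ :=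
  if x ∈ S then l - k * m x else if x ∈ Q then k else 0

lemma relCoeff_left {x : ι → ℤ} (hx : x ∈ S) (l k : ℝ) :
    relCoeff S Q m l k x = l - k * m x := by simp [relCoeff, hx]

lemma relCoeff_right (h : IsKleinschmidt S Q m) {x : ι → ℤ} (hx : x ∈ Q) (l k : ℝ) :
    relCoeff S Q m l k x = k := by
  simp [relCoeff, hx, Finset.disjoint_right.1 h.disjoint hx]

lemma sum_relCoeff (h : IsKleinschmidt S Q m) (l k : ℝ) :
    ∑ x ∈ S ∪ Q, relCoeff S Q m l k x • toReal x = 0 := by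
  rw [Finset.sum_union h.disjoint]
  have h1 : ∑ x ∈ S, toReal x = 0 := by
    rw [← toReal_sum, h.sum_left]; funext k; simp [toReal]
  have h2 : ∑ x ∈ Q, toReal x = ∑ x ∈ S, (m x : ℝ) • toReal x := by
    rw [← toReal_sum, h.sum_right, toReal_sum]
    exact Finset.sum_congr rfl fun x _ => toReal_nsmul _ _
  have e1 : ∑ x ∈ S, relCoeff S Q m l k x • toReal x =
      l • ∑ x ∈ S, toReal x - k • ∑ x ∈ S, (m x : ℝ) • toReal x := by
    rw [Finset.smul_sum, Finset.smul_sum, ← Finset.sum_sub_distrib]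
    refine Finset.sum_congr rfl fun x hx => ?_
    rw [relCoeff_left hx, sub_smul, smul_smul]
  have e2 : ∑ x ∈ Q, relCoeff S Q m l k x • toReal x = k • ∑ x ∈ Q, toReal x := by
    rw [Finset.smul_sum]
    exact Finset.sum_congr rfl fun x hx => by rw [h.relCoeff_right hx]
  rw [e1, e2, h1, h2]
  simp

/-- Subtracting the known relation with the same values at one s and one q leaves a relation between
members of a basis. The relation space is therefore two-dimensional. -/
lemma sub_eq_relCoeff (h : IsKleinschmidt S Q m) {a : (ι → ℤ) → ℝ}
    (ha : ∑ x ∈ S ∪ Q, a x • toReal x = 0) :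
    ∃ l k : ℝ, (∀ x ∈ S, a x = l - k * m x) ∧ ∀ x ∈ Q, a x = k := by
  obtain ⟨s, hs⟩ := Finset.card_pos.1 (zero_lt_one.trans h.one_lt_left)
  obtain ⟨q, hq⟩ := Finset.card_pos.1 (zero_lt_one.trans h.one_lt_right)
  refine ⟨a s + a q * m s, a q, ?_⟩
  have key := h.coeff_eq_zero hs hq
    (a := fun x => a x - relCoeff S Q m (a s + a q * m s) (a q) x)
    (by simp [relCoeff_left hs]) (by simp [h.relCoeff_right hq])
    (by simp only [sub_smul, Finset.sum_sub_distrib, ha, h.sum_relCoeff, sub_zero])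
  constructor
  · intro x hx
    have := key x (Finset.mem_union_left _ hx)
    rw [relCoeff_left hx] at this
    linarith
  · intro x hx
    have := key x (Finset.mem_union_right _ hx)
    rw [h.relCoeff_right hx] at this
    linarith

/-- This is what makes cones meet in common faces. The difference of the two coefficient functions
is constant on Q, nonpositive at q and nonnegative at q', hence zero there; the same argument then
works on S. -/
lemma coeff_unique (h : IsKleinschmidt S Q m) {a a' : (ι → ℤ) → ℝ}
    (ha : ∀ x, 0 ≤ a x) (ha' : ∀ x, 0 ≤ a' x) {s q s' q' : ι → ℤ}
    (hs : s ∈ S) (hq : q ∈ Q) (hs' : s' ∈ S) (hq' : q' ∈ Q)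
    (has : a s = 0) (haq : a q = 0) (has' : a' s' = 0) (haq' : a' q' = 0)
    (e : ∑ x ∈ S ∪ Q, a x • toReal x = ∑ x ∈ S ∪ Q, a' x • toReal x) :
    ∀ x ∈ S ∪ Q, a x = a' x := by
  obtain ⟨l, k, hl, hk⟩ := h.sub_eq_relCoeff (a := fun x => a x - a' x)
    (by simp only [sub_smul, Finset.sum_sub_distrib, e, sub_self])
  have hk0 : k = 0 := by
    have h1 := hk q hq
    have h2 := hk q' hq'
    have := ha q'
    have := ha' q
    linarith
  subst hk0
  have hl0 : l = 0 := by
    have h1 := hl s hs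
    have h2 := hl s' hs'
    have := ha s'
    have := ha' s
    linarith
  subst hl0
  intro x hx
  rcases Finset.mem_union.1 hx with hx | hx
  · have := hl x hx
    linarith
  · have := hk x hx
    linarith

lemma isSimplicialFan (h : IsKleinschmidt S Q m) : IsSimplicialFan (kleinschmidtFan S Q) where
  finite := ((S ∪ Q).powerset.finite_toSet).subset fun A hA => by
    simpa only [Finset.mem_coe, Finset.mem_powerset] using hA.1
  nonempty := by
    refine ⟨∅, by simp, fun hS => absurd h.one_lt_left ?_, fun hQ => absurd h.one_lt_right ?_⟩
    · simp [Finset.subset_empty.1 hS]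
    · simp [Finset.subset_empty.1 hQ]
  primitive := by
    intro A hA x hx
    obtain ⟨e, he⟩ := h.exists_basis_of_mem hA
    obtain ⟨f, hf, -⟩ := exists_dual e he hx
    exact isPrimitive_of_functional f hf
  linearIndependent := by
    intro A hA
    obtain ⟨e, he⟩ := h.exists_basis_of_mem hA
    exact linearIndependent_of_basis e he
  face := fun A hA B hB => ⟨hB.trans hA.1, fun hS => hA.2.1 (hS.trans hB),
    fun hQ => hA.2.2 (hQ.trans hB)⟩
  inter := by
    intro A hA B hB
    have hAB : A ∩ B ⊆ S ∪ Q := Finset.inter_subset_left.trans hA.1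
    ext v
    rw [Set.mem_inter_iff, mem_cone_iff hA.1, mem_cone_iff hB.1, mem_cone_iff hAB]
    constructor
    · rintro ⟨⟨a, ha, ha0, rfl⟩, ⟨a', ha', ha0', e⟩⟩
      obtain ⟨s, hs, hsA⟩ := Finset.not_subset.1 hA.2.1
      obtain ⟨q, hq, hqA⟩ := Finset.not_subset.1 hA.2.2
      obtain ⟨s', hs', hsB⟩ := Finset.not_subset.1 hB.2.1
      obtain ⟨q', hq', hqB⟩ := Finset.not_subset.1 hB.2.2
      have key := h.coeff_unique ha ha' hs hq hs' hq' (ha0 s hsA) (ha0 q hqA) (ha0' s' hsB)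
        (ha0' q' hqB) e
      refine ⟨a, ha, fun x hx => ?_, rfl⟩
      by_cases hxA : x ∈ A
      · rw [key x (hA.1 hxA)]
        exact ha0' x fun hxB => hx (Finset.mem_inter.2 ⟨hxA, hxB⟩)
      · exact ha0 x hxA
    · rintro ⟨a, ha, ha0, rfl⟩
      exact ⟨⟨a, ha, fun x hx => ha0 x fun hx' => hx (Finset.mem_inter.1 hx').1, rfl⟩,
        ⟨a, ha, fun x hx => ha0 x fun hx' => hx (Finset.mem_inter.1 hx').2, rfl⟩⟩

lemma exists_coeff (h : IsKleinschmidt S Q m) (v : ι → ℝ) :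
    ∃ a : (ι → ℤ) → ℝ, v = ∑ x ∈ S ∪ Q, a x • toReal x := by
  classical
  have hz : ∀ y : ι → ℤ, ∃ a : (ι → ℤ) → ℝ, toReal y = ∑ x ∈ S ∪ Q, a x • toReal x := by
    intro y
    have hy : y ∈ Submodule.span ℤ ((S ∪ Q : Finset (ι → ℤ)) : Set (ι → ℤ)) := by
      rw [h.span]; trivial
    obtain ⟨f, -, hf⟩ := Submodule.mem_span_finset.1 hy
    refine ⟨fun x => f x, ?_⟩
    rw [← hf, toReal_sum]
    refine Finset.sum_congr rfl fun x _ => ?_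
    funext k
    simp [toReal]
  choose g hg using hz
  refine ⟨fun x => ∑ k, v k * g (Pi.single k 1) x, ?_⟩
  calc v = ∑ k, v k • toReal (Pi.single k 1) := by
        simp only [toReal_single]
        funext l
        simp [Finset.sum_apply, Pi.single_apply]
    _ = ∑ k, v k • ∑ x ∈ S ∪ Q, g (Pi.single k 1) x • toReal x :=
        Finset.sum_congr rfl fun k _ => by rw [← hg]
    _ = _ := by
        simp only [Finset.smul_sum, Finset.sum_smul, smul_smul]
        rw [Finset.sum_comm]

/-- Start from any real coefficients and subtract the relation that makes the minimum over Q, and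
then the minimum over S, equal to zero. -/
lemma isComplete (h : IsKleinschmidt S Q m) : IsComplete (kleinschmidtFan S Q) := by
  classical
  intro v
  obtain ⟨a, rfl⟩ := h.exists_coeff v
  obtain ⟨q, hq, hqmin⟩ := Finset.exists_min_image Q a
    (Finset.card_pos.1 (zero_lt_one.trans h.one_lt_right))
  -- Clearing the coefficient of q with multiplier `a q` adds `a q * m x` on S, so the minimum is
  -- taken after this correction.
  obtain ⟨s, hs, hsmin⟩ := Finset.exists_min_image S (fun x => a x + a q * m x)
    (Finset.card_pos.1 (zero_lt_one.trans h.one_lt_left))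
  set r := relCoeff S Q m (a s + a q * m s) (a q) with hr
  have hsq : s ≠ q := fun e => Finset.disjoint_left.1 h.disjoint hs (e ▸ hq)
  have has : a s - r s = 0 := by rw [hr, relCoeff_left hs]; ring
  have haq : a q - r q = 0 := by rw [hr, h.relCoeff_right hq]; ring
  have e : ∑ x ∈ S ∪ Q, a x • toReal x =
      ∑ x ∈ ((S ∪ Q).erase s).erase q, (a x - r x) • toReal x := by
    rw [Finset.sum_erase _ (by rw [haq, zero_smul]), Finset.sum_erase _ (by rw [has, zero_smul])]
    simp only [sub_smul, Finset.sum_sub_distrib, hr, h.sum_relCoeff, sub_zero]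
  refine ⟨((S ∪ Q).erase s).erase q, ⟨?_, ?_, ?_⟩, fun x => a x - r x, ?_, e⟩
  · exact (Finset.erase_subset _ _).trans (Finset.erase_subset _ _)
  · exact fun hS => by simpa using hS hs
  · exact fun hQ => by simpa using hQ hq
  · intro x hx
    simp only [Finset.mem_erase, Finset.mem_union] at hx
    rcases hx.2.2 with hxS | hxQ
    · have := hsmin x hxS
      dsimp only at this ⊢
      rw [hr, relCoeff_left hxS]
      linarith
    · have := hqmin x hxQ
      dsimp only
      rw [hr, h.relCoeff_right hxQ]
      linarith

/-- The values at the rays of a strictly convex support function. -/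
def height (S Q : Finset (ι → ℤ)) (m : (ι → ℤ) → ℕ) (x : ι → ℤ) : ℤ :=
  if x ∈ S then -1 else if x ∈ Q then -(1 + ∑ y ∈ S, (m y : ℤ)) else 0

/-- On each maximal cone the support function is given by a character, which is larger at all the
rays outside of the cone. -/
lemma exists_support (h : IsKleinschmidt S Q m) {A : Finset (ι → ℤ)}
    (hA : A ∈ kleinschmidtFan S Q) (hc : A.card = Fintype.card ι) :
    ∃ w : ι → ℤ, (∀ x ∈ A, pairing w (toReal x) = height S Q m x) ∧
      ∀ x ∈ S ∪ Q, x ∉ A → (height S Q m x : ℝ) < pairing w (toReal x) := by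
  classical
  obtain ⟨s, hs, hsA⟩ := Finset.not_subset.1 hA.2.1
  obtain ⟨q, hq, hqA⟩ := Finset.not_subset.1 hA.2.2
  have hsq : ∀ x ∈ S, x ∉ Q := fun x hx hx' => Finset.disjoint_left.1 h.disjoint hx hx'
  set B := ((S ∪ Q).erase s).erase q with hB
  have hAB : A ⊆ B := fun x hx => by
    simp only [hB, Finset.mem_erase]
    exact ⟨fun e => hqA (e ▸ hx), fun e => hsA (e ▸ hx), hA.1 hx⟩
  have hBc : B.card = Fintype.card ι := by
    rw [hB, Finset.card_erase_of_mem, Finset.card_erase_of_mem,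
      Finset.card_union_of_disjoint h.disjoint, h.card]
    · omega
    · exact Finset.mem_union_left _ hs
    · exact Finset.mem_erase.2 ⟨fun e => hsq s hs (e ▸ hq), Finset.mem_union_right _ hq⟩
  have hABe : A = B := Finset.eq_of_subset_of_card_le hAB (by omega)
  obtain ⟨e, he⟩ := h.exists_basis hs hq
  set f : (ι → ℤ) →ₗ[ℤ] ℤ := e.constr ℤ (fun k => height S Q m (e k)) with hf
  have hfB : ∀ x ∈ B, f x = height S Q m x := by
    intro x hx
    have hx' : x ∈ Set.range e := by rw [he]; exact hx
    obtain ⟨k, rfl⟩ := hx'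
    rw [hf, Module.Basis.constr_basis]
  have hS : ∀ x ∈ S, height S Q m x = -1 := fun x hx => by simp [height, hx]
  have hQ : ∀ x ∈ Q, height S Q m x = -(1 + ∑ y ∈ S, (m y : ℤ)) := fun x hx => by
    simp [height, hx, Finset.disjoint_right.1 h.disjoint hx]
  have hfS : ∀ x ∈ S.erase s, f x = -1 := by
    intro x hx
    rw [Finset.mem_erase] at hx
    rw [hfB x, hS x hx.2]
    simp only [hB, Finset.mem_erase, Finset.mem_union]
    exact ⟨fun e => hsq x hx.2 (e ▸ hq), hx.1, Or.inl hx.2⟩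
  have hfQ : ∀ x ∈ Q.erase q, f x = -(1 + ∑ y ∈ S, (m y : ℤ)) := by
    intro x hx
    rw [Finset.mem_erase] at hx
    rw [hfB x, hQ x hx.2]
    simp only [hB, Finset.mem_erase, Finset.mem_union]
    exact ⟨hx.1, fun e => hsq s hs (e ▸ hx.2), Or.inr hx.2⟩
  have hfs : 0 ≤ f s := by
    have e1 := congrArg f h.sum_left
    rw [map_sum, map_zero, ← Finset.add_sum_erase S _ hs, Finset.sum_congr rfl hfS] at e1
    simp only [Finset.sum_const, nsmul_eq_mul] at e1
    have : (0 : ℤ) ≤ ((S.erase s).card : ℤ) := Int.natCast_nonneg _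
    linarith
  have hfS' : ∀ x ∈ S, -1 ≤ f x := by
    intro x hx
    by_cases e : x = s
    · rw [e]; linarith
    · exact (hfS x (Finset.mem_erase.2 ⟨e, hx⟩)).ge
  have hM : 0 ≤ ∑ y ∈ S, (m y : ℤ) := Finset.sum_nonneg fun _ _ => Int.natCast_nonneg _
  -- The relation for Q bounds `f q` below by minus the sum of the m's, because f is at least -1 on
  -- S. The height on Q was set one below this bound to make the inequality strict.
  have hfq : - ∑ y ∈ S, (m y : ℤ) ≤ f q := by
    have e1 := congrArg f h.sum_right
    rw [map_sum, map_sum, ← Finset.add_sum_erase Q _ hq, Finset.sum_congr rfl hfQ] at e1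
    simp only [Finset.sum_const, map_nsmul] at e1
    simp only [nsmul_eq_mul] at e1
    have h1 : - ∑ y ∈ S, (m y : ℤ) ≤ ∑ x ∈ S, (m x : ℤ) * f x := by
      rw [← Finset.sum_neg_distrib]
      refine Finset.sum_le_sum fun x hx => ?_
      have := hfS' x hx
      have : (0 : ℤ) ≤ m x := Int.natCast_nonneg _
      nlinarith
    have : (0 : ℤ) ≤ ((Q.erase q).card : ℤ) := Int.natCast_nonneg _
    nlinarith
  obtain ⟨w, hw⟩ := exists_pairing_eq f
  refine ⟨w, fun x hx => by rw [hw, hfB x (hABe ▸ hx)], fun x hx hxA => ?_⟩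
  rw [hw, Int.cast_lt]
  have hx' : x = s ∨ x = q := by
    rw [hABe, hB] at hxA
    simp only [Finset.mem_erase] at hxA
    tauto
  rcases hx' with rfl | rfl
  · rw [hS x hs]; linarith
  · rw [hQ x hq]; linarith

lemma isProjective (h : IsKleinschmidt S Q m) : IsProjective (kleinschmidtFan S Q) := by
  classical
  refine ⟨h.isComplete, ?_⟩
  have key : ∀ A : Finset (ι → ℤ), ∃ w : ι → ℤ,
      A ∈ kleinschmidtFan S Q → A.card = Fintype.card ι →
      (∀ x ∈ A, pairing w (toReal x) = height S Q m x) ∧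
      ∀ x ∈ S ∪ Q, x ∉ A → (height S Q m x : ℝ) < pairing w (toReal x) := by
    intro A
    by_cases hA : A ∈ kleinschmidtFan S Q ∧ A.card = Fintype.card ι
    · obtain ⟨w, hw⟩ := h.exists_support hA.1 hA.2
      exact ⟨w, fun _ _ => hw⟩
    · exact ⟨0, fun h1 h2 => absurd ⟨h1, h2⟩ hA⟩
  choose w hw using key
  refine ⟨w, fun A hA hAc B hB hBc v hv => ?_⟩
  obtain ⟨hA1, hA2⟩ := hw A hA hAc
  obtain ⟨hB1, -⟩ := hw B hB hBc
  have hle : ∀ x ∈ B, pairing (w B) (toReal x) ≤ pairing (w A) (toReal x) := by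
    intro x hx
    rw [hB1 x hx]
    by_cases hxA : x ∈ A
    · rw [hA1 x hxA]
    · exact (hA2 x (hB.1 hx) hxA).le
  have hint := h.isSimplicialFan.inter A hA B hB
  obtain ⟨b, hb, rfl⟩ := id hv
  have hterm : ∀ x ∈ B, b x * pairing (w B) (toReal x) ≤ b x * pairing (w A) (toReal x) :=
    fun x hx => mul_le_mul_of_nonneg_left (hle x hx) (hb x hx)
  rw [pairing_sum, pairing_sum]
  refine ⟨Finset.sum_le_sum hterm, fun e => ?_, fun hvA => ?_⟩
  -- Equality of the sums forces equality term by term, and strictness off A kills every coefficient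
  -- outside A.
  · have e' := (Finset.sum_eq_sum_iff_of_le hterm).1 e
    have hb0 : ∀ x ∈ B, x ∉ A → b x = 0 := by
      intro x hx hxA
      have h1 := e' x hx
      have h2 := hA2 x (hB.1 hx) hxA
      rw [← hB1 x hx] at h2
      by_contra hne
      exact h2.ne (mul_left_cancel₀ hne h1)
    have : ∑ x ∈ B, b x • toReal x ∈ cone (A ∩ B) := by
      refine ⟨b, fun x hx => hb x (Finset.mem_inter.1 hx).2, ?_⟩
      symm
      refine Finset.sum_subset Finset.inter_subset_right fun x hx hx' => ?_
      rw [hb0 x hx fun hxA => hx' (Finset.mem_inter.2 ⟨hxA, hx⟩), zero_smul]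
    rw [← hint] at this
    exact this.1
  · have : ∑ x ∈ B, b x • toReal x ∈ cone (A ∩ B) := by
      rw [← hint]; exact ⟨hvA, hv⟩
    obtain ⟨d, -, hd⟩ := this
    rw [← pairing_sum, ← pairing_sum, hd, pairing_sum, pairing_sum]
    refine Finset.sum_congr rfl fun x hx => ?_
    rw [Finset.mem_inter] at hx
    rw [hA1 x hx.1, hB1 x hx.2]

lemma rays_eq (h : IsKleinschmidt S Q m) : rays (kleinschmidtFan S Q) = (S ∪ Q : Finset _) := by
  ext x
  simp only [rays, kleinschmidtFan, Set.mem_ofPred_eq, Finset.singleton_subset_iff, Finset.mem_coe]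
  refine ⟨fun hx => hx.1, fun hx => ⟨hx, fun hS => ?_, fun hQ => ?_⟩⟩
  · have := Finset.card_le_card hS
    have := h.one_lt_left
    simp at *
    omega
  · have := Finset.card_le_card hQ
    have := h.one_lt_right
    simp at *
    omega

/-- The rays span the lattice, so the divisor map is injective and its image has rank d inside a
group of rank d + 2. -/
lemma picardRank_eq (h : IsKleinschmidt S Q m) : picardRank (kleinschmidtFan S Q) = 2 := by
  classical
  have hr := h.rays_eq
  have hfin : Finite (rays (kleinschmidtFan S Q)) := by
    rw [hr]; exact Finset.finite_toSet _
  have : Fintype (rays (kleinschmidtFan S Q)) := Fintype.ofFinite _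
  have hcard : Fintype.card (rays (kleinschmidtFan S Q)) = Fintype.card ι + 2 := by
    rw [← h.card, ← Finset.card_union_of_disjoint h.disjoint, ← Nat.card_eq_fintype_card, hr]
    simp
  have hinj : Function.Injective (divMap (kleinschmidtFan S Q)) := by
    rw [← LinearMap.ker_eq_bot, LinearMap.ker_eq_bot']
    intro f hf
    have hker : (⊤ : Submodule ℤ (ι → ℤ)) ≤ LinearMap.ker f := by
      rw [← h.span, Submodule.span_le]
      intro x hx
      rw [← hr] at hx
      exact congrFun hf ⟨x, hx⟩
    ext x
    simpa using hker (Submodule.mem_top (x := Pi.single x 1))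
  have e := Submodule.finrank_quotient_add_finrank
    (LinearMap.range (divMap (kleinschmidtFan S Q)))
  rw [LinearMap.finrank_range_of_inj hinj, Module.finrank_pi, hcard,
    ← (Pi.basisFun ℤ ι).toDualEquiv.finrank_eq, Module.finrank_pi] at e
  unfold picardRank
  omega

lemma isSmoothProjective (h : IsKleinschmidt S Q m) :
    IsSmoothProjectiveOfPicardRank (kleinschmidtFan S Q) 2 :=
  ⟨h.isSimplicialFan, fun _ hA => h.exists_basis_of_mem hA, h.isProjective, h.picardRank_eq⟩

end IsKleinschmidt

end Kleinschmidt

/-! ### The rays of the Batyrev fan, their linear relations and the sets X_i and P_i. -/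

section Rays

variable {p : Fin 5 → ℕ} {b : Fin (p 3) → ℕ} {c : Fin (p 2) → ℕ}

lemma stdVec_eq_zero {r : RayIdx p} (h : (r.2 : ℕ) = 0 ∧ (r.1 = 1 ∨ r.1 = 2 ∨ r.1 = 4)) :
    stdVec p r = 0 := by
  funext k
  have : k.1 ≠ r := fun e => k.2 (e ▸ h)
  simp [stdVec, this]

lemma sum_add_stdSum (i : Fin 5) (hi : 0 < p i) (hs : i = 1 ∨ i = 2 ∨ i = 4) {w : BLattice p}
    {f : Fin (p i) → BLattice p} (h0 : ∀ j : Fin (p i), (j : ℕ) = 0 → f j = w)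
    (h1 : ∀ j : Fin (p i), (j : ℕ) ≠ 0 → f j = stdVec p ⟨i, j⟩) :
    ∑ j, f j = w + stdSum p i := by
  classical
  have hz : stdVec p ⟨i, ⟨0, hi⟩⟩ = 0 := stdVec_eq_zero ⟨rfl, hs⟩
  rw [stdSum, ← Finset.add_sum_erase _ f (Finset.mem_univ ⟨0, hi⟩),
    ← Finset.add_sum_erase _ (fun j => stdVec p ⟨i, j⟩) (Finset.mem_univ ⟨0, hi⟩), hz, zero_add,
    h0 _ rfl]
  congr 1
  refine Finset.sum_congr rfl fun j hj => h1 j fun e => ?_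
  exact (Finset.mem_erase.1 hj).1 (Fin.ext e)

lemma ray_zero (j : Fin (p 0)) : ray p b c ⟨0, j⟩ = stdVec p ⟨0, j⟩ := by simp [ray]

lemma ray_two (j : Fin (p 2)) : ray p b c ⟨2, j⟩ = zVec p j := by simp [ray, zVec]

lemma ray_three (j : Fin (p 3)) : ray p b c ⟨3, j⟩ = stdVec p ⟨3, j⟩ := by simp [ray]

lemma sum_ray_one (hp : ∀ i, 0 < p i) :
    ∑ j, ray p b c ⟨1, j⟩ = yOne p b c + stdSum p 1 :=
  sum_add_stdSum 1 (hp 1) (by simp) (fun j hj => by simp [ray, hj]) fun j hj => by simp [ray, hj]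

lemma sum_ray_two (hp : ∀ i, 0 < p i) : ∑ j, ray p b c ⟨2, j⟩ = zOne p + stdSum p 2 :=
  sum_add_stdSum 2 (hp 2) (by simp) (fun j hj => by simp [ray, hj]) fun j hj => by simp [ray, hj]

lemma sum_ray_four (hp : ∀ i, 0 < p i) :
    ∑ j, ray p b c ⟨4, j⟩ = uOne p b c + stdSum p 4 :=
  sum_add_stdSum 4 (hp 4) (by simp) (fun j hj => by simp [ray, hj]) fun j hj => by simp [ray, hj]

lemma sum_ray_zero : ∑ j, ray p b c ⟨0, j⟩ = stdSum p 0 :=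
  Finset.sum_congr rfl fun j _ => ray_zero j

lemma sum_ray_three : ∑ j, ray p b c ⟨3, j⟩ = stdSum p 3 :=
  Finset.sum_congr rfl fun j _ => ray_three j

lemma sum_one_add_sum_two (hp : ∀ i, 0 < p i) :
    ∑ j, ray p b c ⟨1, j⟩ + ∑ j, ray p b c ⟨2, j⟩ = ∑ j, ray p b c ⟨4, j⟩ := by
  rw [sum_ray_one hp, sum_ray_two hp, sum_ray_four hp, yOne]
  abel

lemma sum_two_add_sum_three (hp : ∀ i, 0 < p i) :
    ∑ j, ray p b c ⟨2, j⟩ + ∑ j, ray p b c ⟨3, j⟩ = 0 := by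
  rw [sum_ray_two hp, sum_ray_three, zOne]
  abel

lemma sum_four_add_sum_zero (hp : ∀ i, 0 < p i) :
    ∑ j, ray p b c ⟨4, j⟩ + ∑ j, ray p b c ⟨0, j⟩ =
      ∑ j, c j • ray p b c ⟨2, j⟩ + ∑ j, b j • ray p b c ⟨3, j⟩ := by
  rw [sum_ray_four hp, sum_ray_zero, uOne]
  simp only [ray_two, ray_three]
  abel

lemma ray_of_not_special {r : RayIdx p} (h : ¬ ((r.2 : ℕ) = 0 ∧ (r.1 = 1 ∨ r.1 = 2 ∨ r.1 = 4))) :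
    ray p b c r = stdVec p r := by
  unfold ray
  rw [if_neg (by tauto), if_neg (by tauto), if_neg (by tauto)]

/-- Without y_1, z_1 and u_1 the relation involves standard basis vectors only, so each coordinate
isolates one coefficient. -/
lemma coeff_eq_zero_of_special (hp : ∀ i, 0 < p i) {a : RayIdx p → ℝ}
    (h : ∑ r, a r • toReal (ray p b c r) = 0) (h1 : a ⟨1, ⟨0, hp 1⟩⟩ = 0)
    (h2 : a ⟨2, ⟨0, hp 2⟩⟩ = 0) (h4 : a ⟨4, ⟨0, hp 4⟩⟩ = 0) (r : RayIdx p) : a r = 0 := by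
  have hsp : ∀ r : RayIdx p, (r.2 : ℕ) = 0 ∧ (r.1 = 1 ∨ r.1 = 2 ∨ r.1 = 4) → a r = 0 := by
    rintro ⟨i, j, hj⟩ ⟨rfl : j = 0, rfl | rfl | rfl⟩
    exacts [h1, h2, h4]
  by_cases hr : (r.2 : ℕ) = 0 ∧ (r.1 = 1 ∨ r.1 = 2 ∨ r.1 = 4)
  · exact hsp r hr
  · have e := congrFun h ⟨r, hr⟩
    rw [Finset.sum_apply, Finset.sum_eq_single r] at e
    · simpa [ray_of_not_special hr, toReal, stdVec] using e
    · intro r' _ hne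
      by_cases hr' : (r'.2 : ℕ) = 0 ∧ (r'.1 = 1 ∨ r'.1 = 2 ∨ r'.1 = 4)
      · simp [hsp r' hr']
      · simp [ray_of_not_special hr', toReal, stdVec, hne.symm]
    · exact fun hr => absurd (Finset.mem_univ r) hr

/-- The coefficients of the general linear relation between the rays. -/
def relation (b : Fin (p 3) → ℕ) (c : Fin (p 2) → ℕ) (α β γ : ℝ) : RayIdx p → ℝ
  | ⟨0, _⟩ => γ
  | ⟨1, _⟩ => α
  | ⟨2, j⟩ => α + β - γ * c j
  | ⟨3, j⟩ => β - γ * b j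
  | ⟨4, _⟩ => γ - α

lemma sum_relation (hp : ∀ i, 0 < p i) (α β γ : ℝ) :
    ∑ r, relation b c α β γ r • toReal (ray p b c r) = 0 := by
  have e1 := congrArg toReal (sum_one_add_sum_two (b := b) (c := c) hp)
  have e2 := congrArg toReal (sum_two_add_sum_three (b := b) (c := c) hp)
  have e3 := congrArg toReal (sum_four_add_sum_zero (b := b) (c := c) hp)
  have hadd : ∀ x y : BLattice p, toReal (x + y) = toReal x + toReal y := by
    intro x y; funext k; simp [toReal]
  have h0 : toReal (0 : BLattice p) = 0 := by funext k; simp [toReal]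
  simp only [hadd, toReal_sum, toReal_nsmul, h0] at e1 e2 e3
  rw [Fintype.sum_sigma, Fin.sum_univ_five]
  simp only [relation, sub_smul, add_smul, Finset.sum_sub_distrib, Finset.sum_add_distrib,
    ← Finset.smul_sum, mul_smul]
  -- The defining relations eliminate the sums over X_1, X_3 and X_0.
  rw [eq_sub_of_add_eq e1, eq_neg_of_add_eq_zero_right e2, ← sub_eq_zero] at *
  rw [eq_sub_of_add_eq' (sub_eq_zero.1 e3)]
  module

/-- Every linear relation between the rays is a combination of the three relations which define
`y_1`, `z_1` and `u_1`. -/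
lemma exists_relation (hp : ∀ i, 0 < p i) {a : RayIdx p → ℝ}
    (h : ∑ r, a r • toReal (ray p b c r) = 0) :
    ∃ α β γ : ℝ, ∀ r, a r = relation b c α β γ r := by
  -- The parameters are solved from the coefficients of y_1, u_1 and z_1.
  set α := a ⟨1, ⟨0, hp 1⟩⟩ with hα
  set γ := a ⟨4, ⟨0, hp 4⟩⟩ + α with hγ
  set β := a ⟨2, ⟨0, hp 2⟩⟩ - α + γ * c ⟨0, hp 2⟩ with hβ
  refine ⟨α, β, γ, fun r => sub_eq_zero.1 ?_⟩
  refine coeff_eq_zero_of_special (b := b) (c := c) hp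
    (a := fun r => a r - relation b c α β γ r) ?_ ?_ ?_ ?_ r
  · simp only [sub_smul, Finset.sum_sub_distrib, h, sum_relation hp, sub_zero]
  · simp [relation, hα]
  · simp only [relation]; rw [hβ]; ring
  · simp only [relation]; rw [hγ]; ring

/-- Two equal rays with different labels would give a relation with one coefficient 1, one
coefficient -1 and zeros elsewhere, which no choice of parameters realizes. -/
lemma ray_injective (hp : ∀ i, 0 < p i) : Function.Injective (ray p b c) := by
  classical
  intro r r' hrr
  by_contra hne
  obtain ⟨α, β, γ, h⟩ := exists_relation (b := b) (c := c) hp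
    (a := fun x => (if x = r then 1 else 0) - (if x = r' then 1 else 0))
    (by simp [sub_smul, ite_smul, Finset.sum_sub_distrib, hrr])
  -- One label is sampled in each block, preferring those of the two given rays.
  let J : ∀ k, Fin (p k) := fun k =>
    if e : r.1 = k then e ▸ r.2 else if e : r'.1 = k then e ▸ r'.2 else ⟨0, hp k⟩
  have h0 := h ⟨0, J 0⟩
  have h1 := h ⟨1, J 1⟩
  have h2 := h ⟨2, J 2⟩
  have h3 := h ⟨3, J 3⟩
  have h4 := h ⟨4, J 4⟩
  have hr := h r
  have hr' := h r'
  obtain ⟨i, j⟩ := r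
  obtain ⟨i', j'⟩ := r'
  fin_cases i <;> fin_cases i' <;>
    simp [J, relation] at h0 h1 h2 h3 h4 hr hr' hne <;> grind

lemma span_ray : Submodule.span ℤ (Set.range (ray p b c)) = ⊤ := by
  rw [eq_top_iff, ← (Pi.basisFun ℤ (BasisIdx p)).span_eq, Submodule.span_le]
  rintro _ ⟨k, rfl⟩
  refine Submodule.subset_span ⟨k.1, ?_⟩
  rw [ray_of_not_special k.2]
  funext l
  simp [stdVec, Pi.single_apply, Subtype.ext_iff]

lemma card_basisIdx (hp : ∀ i, 0 < p i) : Fintype.card (BasisIdx p) + 3 = ∑ i, p i := by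
  classical
  have h := Fintype.card_subtype_compl
    (fun r : RayIdx p => (r.2 : ℕ) = 0 ∧ (r.1 = 1 ∨ r.1 = 2 ∨ r.1 = 4))
  have e : Finset.univ.filter
      (fun r : RayIdx p => (r.2 : ℕ) = 0 ∧ (r.1 = 1 ∨ r.1 = 2 ∨ r.1 = 4)) =
      {⟨1, ⟨0, hp 1⟩⟩, ⟨2, ⟨0, hp 2⟩⟩, ⟨4, ⟨0, hp 4⟩⟩} := by
    ext ⟨i, j, hj⟩
    simp only [Finset.mem_filter, Finset.mem_univ, true_and, Finset.mem_insert,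
      Finset.mem_singleton]
    constructor
    · rintro ⟨rfl : j = 0, rfl | rfl | rfl⟩ <;> simp
    · rintro (e | e | e) <;> cases e <;> simp
  have e' : Fintype.card {r : RayIdx p // (r.2 : ℕ) = 0 ∧ (r.1 = 1 ∨ r.1 = 2 ∨ r.1 = 4)} = 3 := by
    rw [Fintype.card_subtype, e, Finset.card_insert_of_notMem, Finset.card_insert_of_notMem,
      Finset.card_singleton] <;> simp
  have hc : Fintype.card (RayIdx p) = ∑ i, p i := by simp
  have hle : 3 ≤ ∑ i, p i := by
    rw [← hc, ← e']; exact Fintype.card_subtype_le _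
  rw [e', hc] at h
  have : Fintype.card (BasisIdx p) = ∑ i, p i - 3 := h
  omega

lemma mem_X {i : Fin 5} {x : BLattice p} : x ∈ X p b c i ↔ ∃ j, ray p b c ⟨i, j⟩ = x := by
  simp [X]

lemma ray_mem_X (hp : ∀ i, 0 < p i) {i : Fin 5} {r : RayIdx p} :
    ray p b c r ∈ X p b c i ↔ r.1 = i := by
  rw [mem_X]
  constructor
  · rintro ⟨j, e⟩
    rw [← ray_injective hp e]
  · rintro rfl
    exact ⟨r.2, rfl⟩

lemma eq_of_mem_X (hp : ∀ i, 0 < p i) {i i' : Fin 5} {x : BLattice p} (h : x ∈ X p b c i)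
    (h' : x ∈ X p b c i') : i = i' := by
  obtain ⟨j, rfl⟩ := mem_X.1 h
  exact (ray_mem_X hp).1 h'

lemma disjoint_X (hp : ∀ i, 0 < p i) {i i' : Fin 5} (h : i ≠ i') :
    Disjoint (X p b c i) (X p b c i') :=
  Finset.disjoint_left.2 fun _ hx hx' => h (eq_of_mem_X hp hx hx')

lemma X_nonempty (hp : ∀ i, 0 < p i) (i : Fin 5) : (X p b c i).Nonempty :=
  ⟨_, mem_X.2 ⟨⟨0, hp i⟩, rfl⟩⟩

lemma mem_PC {i : Fin 5} {x : BLattice p} :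
    x ∈ PC p b c i ↔ x ∈ X p b c i ∨ x ∈ X p b c (i + 1) := by
  simp [PC]

lemma PC_subset_iff {i : Fin 5} {A : Finset (BLattice p)} :
    PC p b c i ⊆ A ↔ X p b c i ⊆ A ∧ X p b c (i + 1) ⊆ A := by
  rw [PC, Finset.union_subset_iff]

lemma X_subset_rays (i : Fin 5) : X p b c i ⊆ Finset.univ.image (ray p b c) := by
  intro x hx
  obtain ⟨j, rfl⟩ := mem_X.1 hx
  simp

lemma PC_subset_rays (i : Fin 5) : PC p b c i ⊆ Finset.univ.image (ray p b c) :=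
  Finset.union_subset (X_subset_rays _) (X_subset_rays _)

lemma sum_X (hp : ∀ i, 0 < p i) {M : Type*} [AddCommMonoid M] (i : Fin 5) (f : BLattice p → M) :
    ∑ x ∈ X p b c i, f x = ∑ j, f (ray p b c ⟨i, j⟩) := by
  rw [X, Finset.sum_image]
  intro j _ j' _ e
  simpa using ray_injective hp e

lemma sum_PC (hp : ∀ i, 0 < p i) {M : Type*} [AddCommMonoid M] (i : Fin 5) (f : BLattice p → M) :
    ∑ x ∈ PC p b c i, f x =
      ∑ j, f (ray p b c ⟨i, j⟩) + ∑ j, f (ray p b c ⟨i + 1, j⟩) := by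
  rw [PC, Finset.sum_union (disjoint_X hp (by simp)), sum_X hp, sum_X hp]

lemma card_PC (hp : ∀ i, 0 < p i) (i : Fin 5) : (PC p b c i).card = p i + p (i + 1) := by
  rw [Finset.card_eq_sum_ones, sum_PC hp]
  simp

lemma X_eq_singleton {i : Fin 5} (hi : p i = 1) :
    X p b c i = {ray p b c ⟨i, ⟨0, hi ▸ zero_lt_one⟩⟩} := by
  ext x
  rw [mem_X, Finset.mem_singleton]
  constructor
  · rintro ⟨j, rfl⟩
    congr
    exact Fin.ext (by have := j.2; simp only; omega)
  · rintro rfl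
    exact ⟨_, rfl⟩

lemma PC_not_subset_of_ne (hp : ∀ i, 0 < p i) {i k : Fin 5} (h : k ≠ i) :
    ¬ PC p b c k ⊆ PC p b c i := by
  intro hs
  obtain ⟨h1, h2⟩ := PC_subset_iff.1 hs
  obtain ⟨x, hx⟩ := X_nonempty (b := b) (c := c) hp k
  obtain ⟨y, hy⟩ := X_nonempty (b := b) (c := c) hp (k + 1)
  have e1 : k = i ∨ k = i + 1 := (mem_PC.1 (h1 hx)).imp (eq_of_mem_X hp hx) (eq_of_mem_X hp hx)
  have e2 : k + 1 = i ∨ k + 1 = i + 1 :=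
    (mem_PC.1 (h2 hy)).imp (eq_of_mem_X hp hy) (eq_of_mem_X hp hy)
  clear * - h e1 e2
  revert h e1 e2
  revert i k
  decide

lemma isPrimitiveCollection_PC (hp : ∀ i, 0 < p i) (i : Fin 5) :
    IsPrimitiveCollection (batyrevFan p b c) (PC p b c i) := by
  refine ⟨fun x hx => ⟨?_, fun k hk => ?_⟩, fun h => h.2 i subset_rfl, fun Q hQ =>
    ⟨hQ.1.trans (PC_subset_rays i), fun k hk => ?_⟩⟩
  · exact Finset.singleton_subset_iff.2 (PC_subset_rays i hx)
  · have := Finset.card_le_card hk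
    rw [card_PC hp, Finset.card_singleton] at this
    have := hp k
    have := hp (k + 1)
    omega
  · by_cases e : k = i
    · subst e
      exact hQ.2 hk
    · exact PC_not_subset_of_ne hp e (hk.trans hQ.1)

end Rays

/-! ### Constructing the blowdowns. -/

section Blowdown

variable {p : Fin 5 → ℕ} {b : Fin (p 3) → ℕ} {c : Fin (p 2) → ℕ}

lemma kleinschmidtFan_comm {ι : Type*} [Fintype ι] (S Q : Finset (ι → ℤ)) :
    kleinschmidtFan S Q = kleinschmidtFan Q S := by
  ext A
  simp only [kleinschmidtFan, Set.mem_ofPred_eq, Finset.union_comm S Q]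
  tauto

lemma disjoint_PC (hp : ∀ i, 0 < p i) (i : Fin 5) :
    Disjoint (PC p b c (i + 1)) (PC p b c (i + 4)) := by
  simp only [PC, Finset.disjoint_union_left, Finset.disjoint_union_right]
  refine ⟨⟨?_, ?_⟩, ?_, ?_⟩ <;> refine disjoint_X hp ?_ <;> revert i <;> decide

lemma card_PC_add_card_PC (hp : ∀ i, 0 < p i) {i : Fin 5} (hi : p (i + 3) = 1) :
    (PC p b c (i + 1)).card + (PC p b c (i + 4)).card = Fintype.card (BasisIdx p) + 2 := by
  have h := card_basisIdx hp
  rw [card_PC hp, card_PC hp]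
  rw [Fin.sum_univ_five] at h
  generalize Fintype.card (BasisIdx p) = N at h ⊢
  fin_cases i <;> simp at hi ⊢ <;> omega

lemma index_cases (i k : Fin 5) :
    k = i + 3 ∨ (k = i + 1 ∨ k = i + 1 + 1) ∨ k = i + 4 ∨ k = i + 4 + 1 := by
  revert i k
  decide

lemma ray_eq_of_card_eq_one {i : Fin 5} (hi : p i = 1) (j j' : Fin (p i)) :
    ray p b c ⟨i, j⟩ = ray p b c ⟨i, j'⟩ := by
  congr
  exact Fin.ext (by omega)

/-- The sets `P_{i+1}` and `P_{i+4}` cover all rays except the one in `X_{i+3}`. -/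
lemma mem_PC_union_PC (hp : ∀ i, 0 < p i) {i : Fin 5} (hi : p (i + 3) = 1) {x : BLattice p} :
    x ∈ PC p b c (i + 1) ∪ PC p b c (i + 4) ↔
      x ∈ Finset.univ.image (ray p b c) ∧ x ≠ ray p b c ⟨i + 3, ⟨0, hp _⟩⟩ := by
  constructor
  · intro hx
    refine ⟨Finset.union_subset (PC_subset_rays _) (PC_subset_rays _) hx, ?_⟩
    rintro rfl
    simp only [Finset.mem_union, mem_PC, ray_mem_X hp] at hx
    clear hi
    revert i
    decide
  · rintro ⟨hx, hne⟩
    obtain ⟨⟨k, j⟩, -, rfl⟩ := Finset.mem_image.1 hx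
    simp only [Finset.mem_union, mem_PC, ray_mem_X hp]
    rcases index_cases i k with rfl | h
    · exact absurd (ray_eq_of_card_eq_one hi _ _) hne
    · exact h

lemma span_PC_union_PC (hp : ∀ i, 0 < p i) {i : Fin 5} (hi : p (i + 3) = 1)
    (hu : ∑ x ∈ PC p b c i, x = ray p b c ⟨i + 3, ⟨0, hp _⟩⟩) :
    Submodule.span ℤ ((PC p b c (i + 1) ∪ PC p b c (i + 4) : Finset (BLattice p)) :
      Set (BLattice p)) = ⊤ := by
  have key : ∀ x ∈ Finset.univ.image (ray p b c), x ≠ ray p b c ⟨i + 3, ⟨0, hp _⟩⟩ →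
      x ∈ Submodule.span ℤ ((PC p b c (i + 1) ∪ PC p b c (i + 4) : Finset (BLattice p)) :
        Set (BLattice p)) :=
    fun x hx hne => Submodule.subset_span ((mem_PC_union_PC hp hi).2 ⟨hx, hne⟩)
  rw [eq_top_iff, ← span_ray (b := b) (c := c), Submodule.span_le]
  rintro _ ⟨r, rfl⟩
  by_cases e : ray p b c r = ray p b c ⟨i + 3, ⟨0, hp _⟩⟩
  · rw [e, ← hu]
    refine sum_mem fun x hx => key x (PC_subset_rays i hx) ?_
    rintro rfl
    simp only [mem_PC, ray_mem_X hp] at hx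
    revert hx
    clear * -
    revert i
    decide
  · exact key _ (by simp) e

lemma isKleinschmidt_left (hp : ∀ i, 0 < p i) {i : Fin 5} (hi : p (i + 3) = 1)
    (hu : ∑ x ∈ PC p b c i, x = ray p b c ⟨i + 3, ⟨0, hp _⟩⟩) {m : BLattice p → ℕ}
    (h0 : ∑ x ∈ PC p b c (i + 1), x = 0)
    (h1 : ∑ x ∈ PC p b c (i + 4), x = ∑ x ∈ PC p b c (i + 1), m x • x) :
    IsKleinschmidt (PC p b c (i + 1)) (PC p b c (i + 4)) m where
  disjoint := disjoint_PC hp i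
  one_lt_left := by
    rw [card_PC hp]
    have := hp (i + 1)
    have := hp (i + 1 + 1)
    omega
  one_lt_right := by
    rw [card_PC hp]
    have := hp (i + 4)
    have := hp (i + 4 + 1)
    omega
  card := card_PC_add_card_PC hp hi
  span := span_PC_union_PC hp hi hu
  sum_left := h0
  sum_right := h1

lemma isKleinschmidt_right (hp : ∀ i, 0 < p i) {i : Fin 5} (hi : p (i + 3) = 1)
    (hu : ∑ x ∈ PC p b c i, x = ray p b c ⟨i + 3, ⟨0, hp _⟩⟩) {m : BLattice p → ℕ}
    (h0 : ∑ x ∈ PC p b c (i + 4), x = 0)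
    (h1 : ∑ x ∈ PC p b c (i + 1), x = ∑ x ∈ PC p b c (i + 4), m x • x) :
    IsKleinschmidt (PC p b c (i + 4)) (PC p b c (i + 1)) m where
  disjoint := (disjoint_PC hp i).symm
  one_lt_left := by
    rw [card_PC hp]
    have := hp (i + 4)
    have := hp (i + 4 + 1)
    omega
  one_lt_right := by
    rw [card_PC hp]
    have := hp (i + 1)
    have := hp (i + 1 + 1)
    omega
  card := by rw [add_comm]; exact card_PC_add_card_PC hp hi
  span := by rw [Finset.union_comm]; exact span_PC_union_PC hp hi hu
  sum_left := h0
  sum_right := h1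

lemma X_subset_of_subset_insert (hp : ∀ i, 0 < p i) {i k : Fin 5} (h : k ≠ i)
    {r : RayIdx p} (hr : r.1 = i) {T : Finset (BLattice p)}
    (hs : X p b c k ⊆ insert (ray p b c r) T) : X p b c k ⊆ T := by
  intro x hx
  rcases Finset.mem_insert.1 (hs hx) with rfl | hxT
  · exact absurd (((ray_mem_X hp).1 hx).symm.trans hr) h
  · exact hxT

/-- As X_{i+3} = {u}, the collections P_{i+2} and P_{i+3} only say that a cone through u contains
neither X_{i+2} nor X_{i+4}. Once P_i is adjoined, this is exactly the avoidance of P_{i+1} and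
P_{i+4}. -/
lemma batyrevFan_eq_starSubdivision (hp : ∀ i, 0 < p i) {i : Fin 5} (hi : p (i + 3) = 1) :
    batyrevFan p b c = starSubdivision (kleinschmidtFan (PC p b c (i + 1)) (PC p b c (i + 4)))
      (PC p b c i) (ray p b c ⟨i + 3, ⟨0, hp _⟩⟩) := by
  classical
  set u := ray p b c ⟨i + 3, ⟨0, hp _⟩⟩ with hu
  have h5 : i + 4 + 1 = i := by clear hi hu; revert i; decide
  have h2 : i + 1 + 1 = i + 2 := by clear hi hu; revert i; decide
  have h3 : i + 2 + 1 = i + 3 := by clear hi hu; revert i; decide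
  have h4 : i + 3 + 1 = i + 4 := by clear hi hu; revert i; decide
  have hXu : X p b c (i + 3) = {u} := X_eq_singleton hi
  have huX : ∀ k, u ∈ X p b c k ↔ k = i + 3 := fun k => by rw [hu, ray_mem_X hp, eq_comm]
  have hcov : ∀ k, k = i ∨ k = i + 1 ∨ k = i + 2 ∨ k = i + 3 ∨ k = i + 4 := by
    clear * -; revert i; decide
  have n0 : i ≠ i + 3 := by clear * -; revert i; decide
  have n1 : i + 1 ≠ i + 3 := by clear * -; revert i; decide
  have n2 : i + 2 ≠ i + 3 := by clear * -; revert i; decide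
  have n4 : i + 4 ≠ i + 3 := by clear * -; revert i; decide
  have hXi : ∀ {k R T}, k ≠ i + 3 → R ⊆ insert u T → X p b c k ⊆ R → X p b c k ⊆ T :=
    fun hk hRT hkR => X_subset_of_subset_insert hp hk rfl (hkR.trans hRT)
  ext R
  simp only [starSubdivision, batyrevFan, kleinschmidtFan, Set.mem_union, Set.mem_ofPred_eq,
    PC_subset_iff, h5, h2]
  constructor
  · rintro ⟨hR, hno⟩
    have g0 := hno i
    have g1 := hno (i + 1)
    have g2 := hno (i + 2)
    have g3 := hno (i + 3)
    have g4 := hno (i + 4)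
    simp only [h2, h3, h4, h5, hXu, Finset.singleton_subset_iff] at g0 g1 g2 g3 g4
    by_cases huR : u ∈ R
    · right
      have hPu : ∀ x ∈ PC p b c i, x ≠ u := by
        rintro x hx rfl
        rw [mem_PC, huX, huX] at hx
        tauto
      have hsub : ∀ {k}, k ≠ i → k ≠ i + 1 → X p b c k ⊆ R.erase u ∪ PC p b c i →
          X p b c k ⊆ R := by
        intro k hk hk' h x hx
        rcases Finset.mem_union.1 (h hx) with hx' | hx'
        · exact Finset.mem_of_mem_erase hx'
        · rcases mem_PC.1 hx' with hx' | hx'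
          · exact absurd (eq_of_mem_X hp hx hx') hk
          · exact absurd (eq_of_mem_X hp hx hx') hk'
      -- The smallest candidate for the cone being subdivided: drop u from R and add the whole
      -- centre.
      refine ⟨R.erase u ∪ PC p b c i, ⟨?_, fun h => g2 ⟨hsub ?_ ?_ h.2, huR⟩,
        fun h => g3 ⟨huR, hsub ?_ ?_ h.1⟩⟩, PC_subset_iff.1 Finset.subset_union_right, ?_, g0⟩
      · intro x hx
        rw [mem_PC_union_PC hp hi]
        rcases Finset.mem_union.1 hx with hx | hx
        · exact ⟨hR (Finset.mem_of_mem_erase hx), Finset.ne_of_mem_erase hx⟩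
        · exact ⟨PC_subset_rays i hx, hPu x hx⟩
      any_goals clear * -; revert i; decide
      intro x hx
      by_cases e : x = u
      · simp [e]
      · simp [e, hx]
    · left
      refine ⟨⟨fun x hx => (mem_PC_union_PC hp hi).2 ⟨hR hx, ?_⟩, g1, g4⟩, g0⟩
      rintro rfl
      exact huR hx
  · rintro (⟨⟨hR, g1, g4⟩, g0⟩ | ⟨T, ⟨hT, g1, g4⟩, ⟨hT0, hT1⟩, hRT, g0⟩)
    · have huR : u ∉ R := fun h => ((mem_PC_union_PC hp hi).1 (hR h)).2 rfl
      refine ⟨fun x hx => ((mem_PC_union_PC hp hi).1 (hR hx)).1, fun k => ?_⟩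
      rcases hcov k with rfl | rfl | rfl | rfl | rfl
      · exact g0
      · rwa [h2]
      · rw [h3, hXu, Finset.singleton_subset_iff]; tauto
      · rw [hXu, Finset.singleton_subset_iff]; tauto
      · rwa [h5]
    · refine ⟨fun x hx => ?_, fun k => ?_⟩
      · rcases Finset.mem_insert.1 (hRT hx) with rfl | hx
        · simp [hu]
        · exact ((mem_PC_union_PC hp hi).1 (hT hx)).1
      · rcases hcov k with rfl | rfl | rfl | rfl | rfl
        · exact g0
        · rw [h2]; exact fun h => g1 ⟨hT1, hXi n2 hRT h.2⟩
        · exact fun h => g1 ⟨hT1, hXi n2 hRT h.1⟩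
        · rw [h4]; exact fun h => g4 ⟨hXi n4 hRT h.2, hT0⟩
        · exact fun h => g4 ⟨hXi n4 hRT h.1, hT0⟩

/-- Here u is the sum of P_i with all coefficients 1: this puts it in the relative interior, and a
dual coordinate of one element of P_i takes the value 1 on u, so u is primitive. -/
lemma isBlowdown_of_sum_eq (hp : ∀ i, 0 < p i) {i : Fin 5} (hi : p (i + 3) = 1)
    (hu : ∑ x ∈ PC p b c i, x = ray p b c ⟨i + 3, ⟨0, hp _⟩⟩)
    (hF : IsRegular (kleinschmidtFan (PC p b c (i + 1)) (PC p b c (i + 4)))) :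
    IsBlowdown (batyrevFan p b c) (kleinschmidtFan (PC p b c (i + 1)) (PC p b c (i + 4)))
      (PC p b c i) (ray p b c ⟨i + 3, ⟨0, hp _⟩⟩) := by
  have hP : PC p b c i ∈ kleinschmidtFan (PC p b c (i + 1)) (PC p b c (i + 4)) := by
    refine ⟨fun x hx => (mem_PC_union_PC hp hi).2 ⟨PC_subset_rays i hx, ?_⟩,
      PC_not_subset_of_ne hp (by simp), PC_not_subset_of_ne hp (by simp)⟩
    rintro rfl
    simp only [mem_PC, ray_mem_X hp] at hx
    revert hx
    clear * -
    revert i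
    decide
  refine ⟨hP, ?_, ?_, batyrevFan_eq_starSubdivision hp hi, isPrimitiveCollection_PC hp i⟩
  · obtain ⟨e, he⟩ := hF _ hP
    obtain ⟨x, hx⟩ := X_nonempty (b := b) (c := c) hp i
    have hx : x ∈ PC p b c i := mem_PC.2 (Or.inl hx)
    obtain ⟨f, hf1, hf0⟩ := exists_dual e he hx
    refine isPrimitive_of_functional f ?_
    rw [← hu, map_sum, Finset.sum_eq_single x hf0 (fun h => absurd hx h), hf1]
  · refine ⟨fun _ => 1, fun _ _ => one_pos, ?_⟩
    rw [← hu, toReal_sum]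
    simp

lemma exists_blowdown_left (hp : ∀ i, 0 < p i) {i : Fin 5} (hi : p (i + 3) = 1)
    (hu : ∑ x ∈ PC p b c i, x = ray p b c ⟨i + 3, ⟨0, hp _⟩⟩) {m : BLattice p → ℕ}
    (h0 : ∑ x ∈ PC p b c (i + 1), x = 0)
    (h1 : ∑ x ∈ PC p b c (i + 4), x = ∑ x ∈ PC p b c (i + 1), m x • x) :
    ∃ F, IsSmoothProjectiveOfPicardRank F 2 ∧
      IsBlowdown (batyrevFan p b c) F (PC p b c i) (ray p b c ⟨i + 3, ⟨0, hp _⟩⟩) :=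
  have h := (isKleinschmidt_left hp hi hu h0 h1).isSmoothProjective
  ⟨_, h, isBlowdown_of_sum_eq hp hi hu h.2.1⟩

lemma exists_blowdown_right (hp : ∀ i, 0 < p i) {i : Fin 5} (hi : p (i + 3) = 1)
    (hu : ∑ x ∈ PC p b c i, x = ray p b c ⟨i + 3, ⟨0, hp _⟩⟩) {m : BLattice p → ℕ}
    (h0 : ∑ x ∈ PC p b c (i + 4), x = 0)
    (h1 : ∑ x ∈ PC p b c (i + 1), x = ∑ x ∈ PC p b c (i + 4), m x • x) :
    ∃ F, IsSmoothProjectiveOfPicardRank F 2 ∧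
      IsBlowdown (batyrevFan p b c) F (PC p b c i) (ray p b c ⟨i + 3, ⟨0, hp _⟩⟩) := by
  have h := (isKleinschmidt_right hp hi hu h0 h1).isSmoothProjective
  rw [kleinschmidtFan_comm] at h
  exact ⟨_, h, isBlowdown_of_sum_eq hp hi hu h.2.1⟩

lemma exists_mult (hp : ∀ i, 0 < p i) (g : RayIdx p → ℕ) :
    ∃ m : BLattice p → ℕ, ∀ r, m (ray p b c r) = g r :=
  ⟨Function.extend (ray p b c) g 0, fun _ => (ray_injective hp).extend_apply _ _ _⟩

lemma sum_fin_of_eq_one {n : ℕ} (hn : n = 1) (h : 0 < n) {M : Type*} [AddCommMonoid M]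
    (f : Fin n → M) : ∑ j, f j = f ⟨0, h⟩ := by
  subst hn
  simp

lemma exists_blowdown_zero (hp : ∀ i, 0 < p i) (h3 : p 3 = 1) (hb : b ⟨0, hp 3⟩ = 0)
    (hc : ∀ j, c j = 0) :
    ∃ F, IsSmoothProjectiveOfPicardRank F 2 ∧
      IsBlowdown (batyrevFan p b c) F (PC p b c 0) (ray p b c ⟨3, ⟨0, hp 3⟩⟩) := by
  have e1 := sum_one_add_sum_two (b := b) (c := c) hp
  have e2 := sum_two_add_sum_three (b := b) (c := c) hp
  have e3 := sum_four_add_sum_zero (b := b) (c := c) hp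
  -- P_4 sums to zero, and P_1 sums to the sum of X_4.
  obtain ⟨m, hm⟩ := exists_mult (b := b) (c := c) hp fun r => if r.1 = 4 then 1 else 0
  simp only [hc, zero_smul, Finset.sum_const_zero, zero_add,
    sum_fin_of_eq_one h3 (hp 3) (fun j => b j • ray p b c ⟨3, j⟩), hb] at e3
  have hu : ∑ x ∈ PC p b c 0, x = ray p b c ⟨3, ⟨0, hp 3⟩⟩ := by
    rw [← sum_fin_of_eq_one h3 (hp 3) (fun j => ray p b c ⟨3, j⟩), sum_PC hp]
    change _ + ∑ j, ray p b c ⟨1, j⟩ = _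
    rw [eq_sub_of_add_eq e1, eq_neg_of_add_eq_zero_right e2, eq_neg_of_add_eq_zero_left e3]
    abel
  refine exists_blowdown_right (i := 0) hp h3 hu (m := m) ?_ ?_
  · exact (sum_PC hp 4 _).trans e3
  · refine (sum_PC hp 1 _).trans (Eq.trans ?_ (sum_PC hp 4 _).symm)
    refine e1.trans ?_
    simp [hm]

lemma exists_blowdown_one (hp : ∀ i, 0 < p i) (h4 : p 4 = 1) :
    ∃ F, IsSmoothProjectiveOfPicardRank F 2 ∧
      IsBlowdown (batyrevFan p b c) F (PC p b c 1) (ray p b c ⟨4, ⟨0, hp 4⟩⟩) := by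
  have e1 := sum_one_add_sum_two (b := b) (c := c) hp
  have e2 := sum_two_add_sum_three (b := b) (c := c) hp
  have e3 := sum_four_add_sum_zero (b := b) (c := c) hp
  -- In the sum of P_0 the sums of the u's cancel, and the leftover minus the sum of the z's equals
  -- the sum of the t's; this accounts for the extra 1 on X_3.
  obtain ⟨m, hm⟩ := exists_mult (b := b) (c := c) hp fun
    | ⟨2, j⟩ => c j
    | ⟨3, j⟩ => b j + 1
    | _ => 0
  have hu : ∑ x ∈ PC p b c 1, x = ray p b c ⟨4, ⟨0, hp 4⟩⟩ := by
    rw [← sum_fin_of_eq_one h4 (hp 4) (fun j => ray p b c ⟨4, j⟩), sum_PC hp]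
    exact e1
  refine exists_blowdown_left (i := 1) hp h4 hu (m := m) ?_ ?_
  · exact (sum_PC hp 2 _).trans e2
  · refine (sum_PC hp 0 _).trans (Eq.trans ?_ (sum_PC hp 2 _).symm)
    change _ + ∑ j, ray p b c ⟨1, j⟩ = ∑ j, m (ray p b c ⟨2, j⟩) • ray p b c ⟨2, j⟩ +
      ∑ j, m (ray p b c ⟨3, j⟩) • ray p b c ⟨3, j⟩
    simp only [hm, add_smul, one_smul, Finset.sum_add_distrib]
    rw [← add_assoc, ← e3, ← e1, eq_neg_of_add_eq_zero_right e2]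
    abel

lemma exists_blowdown_three (hp : ∀ i, 0 < p i) (h1 : p 1 = 1) :
    ∃ F, IsSmoothProjectiveOfPicardRank F 2 ∧
      IsBlowdown (batyrevFan p b c) F (PC p b c 3) (ray p b c ⟨1, ⟨0, hp 1⟩⟩) := by
  have e1 := sum_one_add_sum_two (b := b) (c := c) hp
  have e2 := sum_two_add_sum_three (b := b) (c := c) hp
  have e3 := sum_four_add_sum_zero (b := b) (c := c) hp
  obtain ⟨m, hm⟩ := exists_mult (b := b) (c := c) hp fun
    | ⟨2, j⟩ => c j
    | ⟨3, j⟩ => b j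
    | _ => 0
  have hu : ∑ x ∈ PC p b c 3, x = ray p b c ⟨1, ⟨0, hp 1⟩⟩ := by
    rw [← sum_fin_of_eq_one h1 (hp 1) (fun j => ray p b c ⟨1, j⟩), sum_PC hp]
    change _ + ∑ j, ray p b c ⟨4, j⟩ = _
    rw [← e1, eq_neg_of_add_eq_zero_right e2]
    abel
  refine exists_blowdown_right (i := 3) hp h1 hu (m := m) ?_ ?_
  · exact (sum_PC hp 2 _).trans e2
  · refine (sum_PC hp 4 _).trans (Eq.trans ?_ (sum_PC hp 2 _).symm)
    refine e3.trans ?_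
    change _ = ∑ j, m (ray p b c ⟨2, j⟩) • ray p b c ⟨2, j⟩ +
      ∑ j, m (ray p b c ⟨3, j⟩) • ray p b c ⟨3, j⟩
    simp only [hm]

lemma exists_blowdown_four (hp : ∀ i, 0 < p i) (h2 : p 2 = 1) (hc : c ⟨0, hp 2⟩ = 1)
    (hb : ∀ j, b j = 0) :
    ∃ F, IsSmoothProjectiveOfPicardRank F 2 ∧
      IsBlowdown (batyrevFan p b c) F (PC p b c 4) (ray p b c ⟨2, ⟨0, hp 2⟩⟩) := by
  have e1 := sum_one_add_sum_two (b := b) (c := c) hp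
  have e2 := sum_two_add_sum_three (b := b) (c := c) hp
  have e3 := sum_four_add_sum_zero (b := b) (c := c) hp
  -- P_0 sums to zero, and P_3 sums to the sum of X_1.
  obtain ⟨m, hm⟩ := exists_mult (b := b) (c := c) hp fun r => if r.1 = 1 then 1 else 0
  simp only [hb, zero_smul, Finset.sum_const_zero, add_zero,
    sum_fin_of_eq_one h2 (hp 2) (fun j => c j • ray p b c ⟨2, j⟩), hc, one_smul] at e3
  have hz := sum_fin_of_eq_one h2 (hp 2) (fun j => ray p b c ⟨2, j⟩)
  have hu : ∑ x ∈ PC p b c 4, x = ray p b c ⟨2, ⟨0, hp 2⟩⟩ := (sum_PC hp 4 _).trans e3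
  refine exists_blowdown_left (i := 4) hp h2 hu (m := m) ?_ ?_
  · refine (sum_PC hp 0 _).trans ?_
    change _ + ∑ j, ray p b c ⟨1, j⟩ = _
    rw [eq_sub_of_add_eq e1, eq_sub_of_add_eq' e3, hz]
    abel
  · refine (sum_PC hp 3 _).trans (Eq.trans ?_ (sum_PC hp 0 _).symm)
    change _ + ∑ j, ray p b c ⟨4, j⟩ = ∑ j, m (ray p b c ⟨0, j⟩) • ray p b c ⟨0, j⟩ +
      ∑ j, m (ray p b c ⟨1, j⟩) • ray p b c ⟨1, j⟩
    rw [← e1, eq_neg_of_add_eq_zero_right e2]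
    simp [hm]

end Blowdown

/-! ### Constraints on the contracted ray in an arbitrary blowdown. -/

section BlowdownCenter

variable {ι : Type*} [Fintype ι] {F' F : Set (Finset (ι → ℤ))} {P : Finset (ι → ℤ)} {u : ι → ℤ}

/-- Otherwise u would have two expressions in P: itself alone, and one with all coefficients
positive. -/
lemma IsBlowdown.notMem_center (h : IsBlowdown F' F P u) (hF : IsRegular F) (hP : 1 < P.card) :
    u ∉ P := by
  classical
  intro huP
  obtain ⟨hPF, -, ⟨a, ha, hua⟩, -, -⟩ := h
  obtain ⟨e, he⟩ := hF P hPF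
  obtain ⟨x, hx, hxu⟩ := Finset.exists_mem_ne hP u
  have h0 := coeff_eq_zero_of_sum_eq_zero (a := fun y => a y - if y = u then 1 else 0) e he
    (by simp [sub_smul, Finset.sum_sub_distrib, ite_smul, huP, ← hua]) hx
  have := ha x hx
  simp only [if_neg hxu] at h0
  linarith

/-- The ray of u would meet the cone of P only in the origin, although u lies in that cone and is
nonzero. -/
lemma IsBlowdown.singleton_notMem (h : IsBlowdown F' F P u) (hF : IsSimplicialFan F)
    (hu : u ∉ P) : {u} ∉ F := by
  intro huF
  obtain ⟨hPF, hprim, ⟨a, ha, hua⟩, -, -⟩ := h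
  have hmem : toReal u ∈ cone P ∩ cone {u} :=
    ⟨⟨a, fun x hx => (ha x hx).le, hua⟩, ⟨fun _ => 1, fun _ _ => zero_le_one, by simp⟩⟩
  rw [hF.inter P hPF {u} huF, Finset.inter_singleton_of_notMem hu] at hmem
  obtain ⟨d, -, hd⟩ := hmem
  rw [Finset.sum_empty] at hd
  have hu0 : u = 0 := by
    funext k
    have := congrFun hd k
    simpa [toReal] using this
  have := hprim 0 0 (by simp [hu0])
  omega

lemma IsBlowdown.singleton_mem (h : IsBlowdown F' F P u) (hP : 1 < P.card) : {u} ∈ F' := by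
  obtain ⟨hPF, -, -, hstar, -⟩ := h
  rw [hstar]
  refine Or.inr ⟨P, hPF, subset_rfl, by simp, fun hs => ?_⟩
  have := Finset.card_le_card hs
  rw [Finset.card_singleton] at this
  omega

/-- A cone through u is not in F, so it comes from subdividing some T that contains P; adding
elements of P stays within the same T. -/
lemma IsBlowdown.union_mem (h : IsBlowdown F' F P u) (hF : IsSimplicialFan F) (hu : u ∉ P)
    {R Q : Finset (ι → ℤ)} (hR : R ∈ F') (huR : u ∈ R) (hQ : Q ⊆ P) (hRQ : ¬ P ⊆ R ∪ Q) :
    R ∪ Q ∈ F' := by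
  have hnot := h.singleton_notMem hF hu
  obtain ⟨hPF, -, -, hstar, -⟩ := h
  rw [hstar] at hR ⊢
  rcases hR with ⟨hRF, -⟩ | ⟨T, hT, hPT, hRT, -⟩
  · exact absurd (hF.face R hRF _ (Finset.singleton_subset_iff.2 huR)) hnot
  · exact Or.inr ⟨T, hT, hPT, Finset.union_subset hRT
      ((hQ.trans hPT).trans (Finset.subset_insert _ _)), hRQ⟩

end BlowdownCenter

/-! ### Which centres and coefficients can occur. -/

section Classification

variable {p : Fin 5 → ℕ} {b : Fin (p 3) → ℕ} {c : Fin (p 2) → ℕ}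

lemma IsPrimitiveCollection.eq_PC (hp : ∀ i, 0 < p i) {P : Finset (BLattice p)}
    (h : IsPrimitiveCollection (batyrevFan p b c) P) : ∃ i, P = PC p b c i := by
  obtain ⟨hr, hP, hQ⟩ := h
  have hsub : P ⊆ Finset.univ.image (ray p b c) := fun x hx =>
    Finset.singleton_subset_iff.1 (hr hx).1
  have : ∃ i, PC p b c i ⊆ P := by
    by_contra hno
    exact hP ⟨hsub, not_exists.1 hno⟩
  obtain ⟨i, hi⟩ := this
  refine ⟨i, ?_⟩
  by_contra hne
  exact (isPrimitiveCollection_PC hp i).2.1 (hQ _ (hi.ssubset_of_ne (Ne.symm hne)))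

lemma X_mem_batyrevFan (hp : ∀ i, 0 < p i) (i : Fin 5) : X p b c i ∈ batyrevFan p b c := by
  refine ⟨X_subset_rays i, fun k hk => ?_⟩
  obtain ⟨h1, h2⟩ := PC_subset_iff.1 hk
  obtain ⟨x, hx⟩ := X_nonempty (b := b) (c := c) hp k
  obtain ⟨y, hy⟩ := X_nonempty (b := b) (c := c) hp (k + 1)
  have e1 := eq_of_mem_X hp hx (h1 hx)
  have e2 := eq_of_mem_X hp hy (h2 hy)
  subst e1
  simp at e2

lemma X_not_subset_of_disjoint (hp : ∀ i, 0 < p i) {i : Fin 5} {T : Finset (BLattice p)}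
    (h : ∀ x ∈ T, x ∉ X p b c i) : ¬ X p b c i ⊆ T := by
  intro hs
  obtain ⟨x, hx⟩ := X_nonempty (b := b) (c := c) hp i
  exact h x (hs hx) hx

/-- The centre of a blowdown is a set `P_i`, and the contracted ray is the only element of
`X_{i+3}`. -/
lemma IsBlowdown.center (hp : ∀ i, 0 < p i) {F : Set (Finset (BLattice p))}
    {P : Finset (BLattice p)} {u : BLattice p} (hF : IsSimplicialFan F) (hreg : IsRegular F)
    (h : IsBlowdown (batyrevFan p b c) F P u) :
    ∃ i, P = PC p b c i ∧ p (i + 3) = 1 ∧ u = ray p b c ⟨i + 3, ⟨0, hp _⟩⟩ := by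
  classical
  obtain ⟨i, rfl⟩ := h.2.2.2.2.eq_PC hp
  refine ⟨i, rfl, ?_⟩
  have hcard : 1 < (PC p b c i).card := by
    rw [card_PC hp]
    have := hp i
    have := hp (i + 1)
    omega
  have huP := h.notMem_center hreg hcard
  obtain ⟨⟨k, j⟩, -, rfl⟩ := Finset.mem_image.1
    (Finset.singleton_subset_iff.1 (h.singleton_mem hcard).1)
  have hno : ∀ {R Q l}, R ∈ batyrevFan p b c → ray p b c ⟨k, j⟩ ∈ R → Q ⊆ PC p b c i →
      ¬ PC p b c i ⊆ R ∪ Q → ¬ PC p b c l ⊆ R ∪ Q :=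
    fun hR huR hQ hRQ => (h.union_mem hF huP hR huR hQ hRQ).2 _
  have hjk : ray p b c ⟨k, j⟩ ∈ X p b c k := mem_X.2 ⟨j, rfl⟩
  have h5 : i + 4 + 1 = i := by clear * -; revert i; decide
  have hL : X p b c i ⊆ PC p b c i := fun x hx => mem_PC.2 (Or.inl hx)
  have hR : X p b c (i + 1) ⊆ PC p b c i := fun x hx => mem_PC.2 (Or.inr hx)
  have n1 : i ≠ i + 2 ∧ i ≠ i + 1 ∧ i + 1 ≠ i + 4 ∧ i + 1 ≠ i + 3 := by
    clear * -; revert i; decide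
  have hk : k = i + 3 := by
    have hcov : k = i ∨ k = i + 1 ∨ k = i + 2 ∨ k = i + 3 ∨ k = i + 4 := by
      clear * -; revert i k; decide
    rcases hcov with rfl | rfl | rfl | rfl | rfl
    · exact absurd (hL hjk) huP
    · exact absurd (hR hjk) huP
    · exfalso
      -- If u were in X_{i+2}, that cone could absorb X_{i+1} and become P_{i+1}.
      refine hno (l := i + 1) (X_mem_batyrevFan hp (i + 2)) hjk hR (fun hs => ?_) ?_
      · refine X_not_subset_of_disjoint hp (fun x hx hx' => ?_) (hL.trans hs)
        rcases Finset.mem_union.1 hx with hx | hx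
        · exact n1.1 (eq_of_mem_X hp hx' hx)
        · exact n1.2.1 (eq_of_mem_X hp hx' hx)
      · rw [PC_subset_iff, show i + 1 + 1 = i + 2 by clear * -; revert i; decide]
        exact ⟨Finset.subset_union_right, Finset.subset_union_left⟩
    · rfl
    · exfalso
      refine hno (l := i + 4) (X_mem_batyrevFan hp (i + 4)) hjk hL (fun hs => ?_) ?_
      · refine X_not_subset_of_disjoint hp (fun x hx hx' => ?_) (hR.trans hs)
        rcases Finset.mem_union.1 hx with hx | hx
        · exact n1.2.2.1 (eq_of_mem_X hp hx' hx)
        · exact n1.2.1 (eq_of_mem_X hp hx hx')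
      · rw [PC_subset_iff, h5]
        exact ⟨Finset.subset_union_left, Finset.subset_union_right⟩
  subst hk
  have hone : p (i + 3) = 1 := by
    by_contra hne
    -- With a second element in X_{i+3}, u together with X_{i+4} spans a cone, which could absorb
    -- X_i and so contain P_{i+4}.
    have hR' : insert (ray p b c ⟨i + 3, j⟩) (X p b c (i + 4)) ∈ batyrevFan p b c := by
      refine ⟨Finset.insert_subset (X_subset_rays _ hjk) (X_subset_rays _), fun l hl => ?_⟩
      have hX : ∀ l, X p b c l ⊆ insert (ray p b c ⟨i + 3, j⟩) (X p b c (i + 4)) → l = i + 4 := by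
        intro l hl
        by_cases e : l = i + 3
        · subst e
          exfalso
          have hsub : X p b c (i + 3) ⊆ {ray p b c ⟨i + 3, j⟩} := by
            intro x hx
            rcases Finset.mem_insert.1 (hl hx) with hx' | hx'
            · exact Finset.mem_singleton.2 hx'
            · have := eq_of_mem_X hp hx hx'
              simp at this
          have := Finset.card_le_card hsub
          rw [Finset.card_eq_sum_ones, sum_X hp, Finset.card_singleton] at this
          have hpi := hp (i + 3)
          simp at this
          omega
        · obtain ⟨x, hx⟩ := X_nonempty (b := b) (c := c) hp l
          exact eq_of_mem_X hp hx (X_subset_of_subset_insert hp e rfl hl hx)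
      obtain ⟨h1, h2⟩ := PC_subset_iff.1 hl
      have e1 := hX _ h1
      have e2 := hX _ h2
      rw [e1] at e2
      simp at e2
    refine hno (l := i + 4) hR' (Finset.mem_insert_self _ _) hL (fun hs => ?_) ?_
    · refine X_not_subset_of_disjoint hp (fun x hx hx' => ?_) (hR.trans hs)
      rcases Finset.mem_union.1 hx with hx | hx
      · rcases Finset.mem_insert.1 hx with rfl | hx
        · exact n1.2.2.2 (eq_of_mem_X hp hx' hjk)
        · exact n1.2.2.1 (eq_of_mem_X hp hx' hx)
      · exact n1.2.1 (eq_of_mem_X hp hx hx')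
    · rw [PC_subset_iff, h5]
      exact ⟨(Finset.subset_insert _ _).trans Finset.subset_union_left,
        Finset.subset_union_right⟩
  exact ⟨hone, ray_eq_of_card_eq_one hone _ _⟩

lemma sum_ite_fst (i : Fin 5) {M : Type*} [AddCommMonoid M] (f : RayIdx p → M) :
    ∑ r, (if r.1 = i then f r else 0) = ∑ j, f ⟨i, j⟩ := by
  rw [Fintype.sum_sigma, Finset.sum_eq_single i]
  · simp
  · intro k _ hk
    simp [hk]
  · simp

/-- The linear relation which expresses the contracted ray by the rays in the centre. -/
lemma IsBlowdown.exists_relation (hp : ∀ i, 0 < p i) {F : Set (Finset (BLattice p))}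
    (hreg : IsRegular F) {i : Fin 5} (hi : p (i + 3) = 1)
    (h : IsBlowdown (batyrevFan p b c) F (PC p b c i) (ray p b c ⟨i + 3, ⟨0, hp _⟩⟩)) :
    ∃ α β γ : ℝ,
      (∀ r : RayIdx p, r.1 = i ∨ r.1 = i + 1 →
        0 < relation b c α β γ r ∧ ∃ n : ℤ, relation b c α β γ r = n) ∧
      (∀ r : RayIdx p, r.1 = i + 3 → relation b c α β γ r = -1) ∧
      ∀ r : RayIdx p, r.1 = i + 2 ∨ r.1 = i + 4 → relation b c α β γ r = 0 := by
  obtain ⟨hPF, -, ⟨a, ha, hua⟩, -, -⟩ := h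
  obtain ⟨e, he⟩ := hreg _ hPF
  have hmem : ∀ r : RayIdx p, r.1 = i ∨ r.1 = i + 1 → ray p b c r ∈ PC p b c i := fun r hr => by
    rwa [mem_PC, ray_mem_X hp, ray_mem_X hp]
  obtain ⟨α, β, γ, hrel⟩ := ToricFan.exists_relation (b := b) (c := c) hp
    -- The expansion of u in P_i with u moved to the other side; the one-element block X_{i+3}
    -- carries the coefficient -1.
    (a := fun r => (if r.1 = i then a (ray p b c r) else 0) +
      (if r.1 = i + 1 then a (ray p b c r) else 0) - (if r.1 = i + 3 then 1 else 0)) (by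
    simp only [sub_smul, add_smul, ite_smul, zero_smul, one_smul, Finset.sum_sub_distrib,
      Finset.sum_add_distrib]
    rw [sum_ite_fst i fun r => a (ray p b c r) • toReal (ray p b c r),
      sum_ite_fst (i + 1) fun r => a (ray p b c r) • toReal (ray p b c r),
      sum_ite_fst (i + 3) fun r => toReal (ray p b c r),
      ← sum_PC hp i fun x => a x • toReal x, ← hua, sum_fin_of_eq_one hi (hp _), sub_self])
  have hval : ∀ r : RayIdx p, r.1 = i ∨ r.1 = i + 1 →
      relation b c α β γ r = a (ray p b c r) := by
    intro r hr
    rw [← hrel r]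
    rcases hr with hr | hr <;> simp [hr]
  refine ⟨α, β, γ, fun r hr => ?_, fun r hr => ?_, fun r hr => ?_⟩
  · rw [hval r hr]
    exact ⟨ha _ (hmem r hr), coeff_integral e he hua (hmem r hr)⟩
  · rw [← hrel r]
    have : i + 3 ≠ i ∧ i + 3 ≠ i + 1 := by clear * -; revert i; decide
    simp [hr, this]
  · rw [← hrel r]
    have : i + 2 ≠ i ∧ i + 2 ≠ i + 1 ∧ i + 2 ≠ i + 3 ∧ i + 4 ≠ i ∧ i + 4 ≠ i + 1 ∧
      i + 4 ≠ i + 3 := by clear * -; revert i; decide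
    rcases hr with hr | hr <;> simp [hr, this]

/-- Eliminating α and β leaves γ (b_1 + 1 - c_j) = 1 in integers, so γ = 1 and every c_j equals b_1;
the normalization makes the common value zero. -/
lemma coeff_of_relation_zero (hp : ∀ i, 0 < p i) (hbc : (∃ j, c j = 0) ∨ (∃ j, b j = 0))
    (h3 : p 3 = 1) {α β γ : ℝ} (hγ : 0 < γ) (hn : ∃ n : ℤ, γ = n)
    (ht : ∀ j, β - γ * b j = -1) (hz : ∀ j, α + β - γ * c j = 0) (hu : γ - α = 0) :
    b ⟨0, hp 3⟩ = 0 ∧ ∀ j, c j = 0 := by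
  obtain ⟨n, rfl⟩ := hn
  have key : ∀ j, n * (b ⟨0, hp 3⟩ + 1 - c j) = 1 := by
    intro j
    have h1 := ht ⟨0, hp 3⟩
    have h2 := hz j
    have : (n : ℝ) * (b ⟨0, hp 3⟩ + 1 - c j) = 1 := by linarith
    exact_mod_cast this
  have hn0 : 0 < n := by exact_mod_cast hγ
  have hn1 : n = 1 := Int.eq_one_of_mul_eq_one_right hn0.le (key ⟨0, hp 2⟩)
  subst hn1
  have hb0 : b ⟨0, hp 3⟩ = 0 := by
    rcases hbc with ⟨j, hj⟩ | ⟨j, hj⟩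
    · have := key j
      omega
    · rwa [show (⟨0, hp 3⟩ : Fin (p 3)) = j from Fin.ext (by simp only; omega)]
  refine ⟨hb0, fun j => ?_⟩
  have := key j
  omega

/-- Eliminating β leaves γ (c_1 - b_j) = 1 in integers, so γ = 1 and c_1 = b_j + 1 for all j. Hence
c_1 is nonzero, the normalization falls on some b_j, and all b_j vanish. -/
lemma coeff_of_relation_four (hp : ∀ i, 0 < p i) (hbc : (∃ j, c j = 0) ∨ (∃ j, b j = 0))
    (h2 : p 2 = 1) {α β γ : ℝ} (hγ : 0 < γ) (hn : ∃ n : ℤ, γ = n)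
    (hα : α = 0) (hz : ∀ j, α + β - γ * c j = -1) (ht : ∀ j, β - γ * b j = 0) :
    c ⟨0, hp 2⟩ = 1 ∧ ∀ j, b j = 0 := by
  obtain ⟨n, rfl⟩ := hn
  have key : ∀ j, n * (c ⟨0, hp 2⟩ - b j) = 1 := by
    intro j
    have h1 := hz ⟨0, hp 2⟩
    have h2 := ht j
    have : (n : ℝ) * (c ⟨0, hp 2⟩ - b j) = 1 := by linarith
    exact_mod_cast this
  have hn0 : 0 < n := by exact_mod_cast hγ
  have hn1 : n = 1 := Int.eq_one_of_mul_eq_one_right hn0.le (key ⟨0, hp 3⟩)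
  subst hn1
  have hc1 : c ⟨0, hp 2⟩ = 1 := by
    rcases hbc with ⟨j, hj⟩ | ⟨j, hj⟩
    · have := key ⟨0, hp 3⟩
      rw [show (⟨0, hp 2⟩ : Fin (p 2)) = j from Fin.ext (by simp only; omega), hj] at this
      omega
    · have := key j
      omega
  refine ⟨hc1, fun j => ?_⟩
  have := key j
  omega

end Classification

end ToricFan

theorem mainTheorem10 (p : Fin 5 → ℕ) (hp : ∀ i, 0 < p i)
    (b : Fin (p 3) → ℕ) (c : Fin (p 2) → ℕ)
    (hbc : (∃ j, c j = 0) ∨ (∃ j, b j = 0))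
    (P : Finset (ToricFan.BLattice p)) (u : ToricFan.BLattice p) :
    (∃ F : Set (Finset (ToricFan.BLattice p)),
        ToricFan.IsSmoothProjectiveOfPicardRank F 2 ∧
        ToricFan.IsBlowdown (ToricFan.batyrevFan p b c) F P u) ↔
      (p 3 = 1 ∧ b ⟨0, hp 3⟩ = 0 ∧ (∀ j, c j = 0) ∧
          P = ToricFan.PC p b c 0 ∧ u = ToricFan.ray p b c ⟨3, ⟨0, hp 3⟩⟩) ∨
      (p 4 = 1 ∧
          P = ToricFan.PC p b c 1 ∧ u = ToricFan.ray p b c ⟨4, ⟨0, hp 4⟩⟩) ∨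
      (p 1 = 1 ∧
          P = ToricFan.PC p b c 3 ∧ u = ToricFan.ray p b c ⟨1, ⟨0, hp 1⟩⟩) ∨
      (p 2 = 1 ∧ c ⟨0, hp 2⟩ = 1 ∧ (∀ j, b j = 0) ∧
          P = ToricFan.PC p b c 4 ∧ u = ToricFan.ray p b c ⟨2, ⟨0, hp 2⟩⟩) := by
  constructor
  · rintro ⟨F, ⟨hF, hreg, -, -⟩, h⟩
    obtain ⟨i, rfl, hi, rfl⟩ := h.center hp hF hreg
    obtain ⟨α, β, γ, hpos, hneg, hzero⟩ := h.exists_relation hp hreg hi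
    have hcov : i = 0 ∨ i = 1 ∨ i = 2 ∨ i = 3 ∨ i = 4 := by clear * -; revert i; decide
    rcases hcov with rfl | rfl | rfl | rfl | rfl
    · obtain ⟨hγ, hn⟩ := hpos ⟨0, ⟨0, hp 0⟩⟩ (Or.inl rfl)
      obtain ⟨hb, hc⟩ := ToricFan.coeff_of_relation_zero hp hbc hi hγ hn
        (fun j => hneg ⟨3, j⟩ rfl) (fun j => hzero ⟨2, j⟩ (Or.inl rfl))
        (hzero ⟨4, ⟨0, hp 4⟩⟩ (Or.inr rfl))
      exact Or.inl ⟨hi, hb, hc, rfl, rfl⟩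
    · exact Or.inr (Or.inl ⟨hi, rfl, rfl⟩)
    -- For i = 2 the contracted ray lies in X_0, which forces γ = -1, while the zeros on X_1 and X_4
    -- force γ = α = 0.
    · exfalso
      have h0 : γ = -1 := hneg ⟨0, ⟨0, hp 0⟩⟩ rfl
      have h1 : α = 0 := hzero ⟨1, ⟨0, hp 1⟩⟩ (Or.inr rfl)
      have h4 : γ - α = 0 := hzero ⟨4, ⟨0, hp 4⟩⟩ (Or.inl rfl)
      linarith
    · exact Or.inr (Or.inr (Or.inl ⟨hi, rfl, rfl⟩))
    · obtain ⟨hγ, hn⟩ := hpos ⟨0, ⟨0, hp 0⟩⟩ (Or.inr rfl)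
      obtain ⟨hc, hb⟩ := ToricFan.coeff_of_relation_four hp hbc hi hγ hn
        (hzero ⟨1, ⟨0, hp 1⟩⟩ (Or.inl rfl)) (fun j => hneg ⟨2, j⟩ rfl)
        (fun j => hzero ⟨3, j⟩ (Or.inr rfl))
      exact Or.inr (Or.inr (Or.inr ⟨hi, hc, hb, rfl, rfl⟩))
  · rintro (⟨h3, hb, hc, rfl, rfl⟩ | ⟨h4, rfl, rfl⟩ | ⟨h1, rfl, rfl⟩ | ⟨h2, hc, hb, rfl, rfl⟩)
    · exact ToricFan.exists_blowdown_zero hp h3 hb hc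
    · exact ToricFan.exists_blowdown_one hp h4
    · exact ToricFan.exists_blowdown_three hp h1
    · exact ToricFan.exists_blowdown_four hp h2 hc hb
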